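/- Let $\alpha,\beta\in(0,1)$ with $\alpha+\beta<1$, let $T=[0,2\pi]$, and let $f:\mathbb R^2\to\mathbb R$ be $2\pi$-periodic in each variable, integrable on $T^2$, and of bounded partial variation ($f\in PBV$), i.e. $$\sup_{y\in T}\ \operatorname{Var}_{T} f(\cdot,y)+\sup_{x\in T}\ \operatorname{Var}_{T} f(x,\cdot)<\infty .$$ Put $$\widehat f(k,l)=\frac1{4\pi^2}\int_0^{2\pi}\!\!\int_0^{2\pi} f(x,y)e^{-ikx}e^{-ily}\,dx\,dy,\qquad S_{M,N}[f,(x,y)]=\sum_{k=-M}^{M}\sum_{l=-N}^{N}\widehat f(k,l)e^{ikx}e^{ily},$$ and, for $a,b>-1$, $$\sigma_{n,m}^{a,b}f(x,y)=\frac1{A_n^{a}A_m^{b}}\sum_{i=0}^{n}\sum_{j=0}^{m}A_{n-i}^{a-1}A_{m-j}^{b-1}S_{i,j}[f,(x,y)],\qquad A_0^a=1,\quad A_k^{a}=\frac{(a+1)\cdots(a+k)}{k!}\ (k\ge 1).$$ Then the double Fourier series of $f$ is $(C;-\alpha,-\beta)$ summable to $\frac14\sum f(x\pm0,y\pm0)$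 wherever this makes sense: at every point $(x,y)$ at which the four open coordinate quadrant limits $f(x\pm0,y\pm0)$ (all four combinations of signs) exist, $$\lim_{n,m\to\infty}\sigma_{n,m}^{-\alpha,-\beta}f(x,y)=\tfrac14\big[f(x+0,y+0)+f(x+0,y-0)+f(x-0,y+0)+f(x-0,y-0)\big],$$ where $n$ and $m$ tend to infinity independently. Moreover, for every compact set $K\subset\mathbb R^2$ such that $f$ is continuous at every point of $K$, $\sigma_{n,m}^{-\alpha,-\beta}f\to f$ uniformly on $K$ as $n,m\to\infty$. -/

import Mathlib

open Filter Topology MeasureTheory Set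
open scoped Real ENNReal

noncomputable section

namespace DoubleFourier

/-- `f` has period `2π` with respect to each of its two variables. -/
def IsBiperiodic (f : ℝ × ℝ → ℝ) : Prop :=
  (∀ x y, f (x + 2 * π, y) = f (x, y)) ∧ (∀ x y, f (x, y + 2 * π) = f (x, y))

/-- Membership in `L¹(T²)`, where `T = [0, 2π]`. -/
def IsL1 (f : ℝ × ℝ → ℝ) : Prop :=
  IntegrableOn f (Icc 0 (2 * π) ×ˢ Icc 0 (2 * π)) volume

/-- Bounded partial variation: the variations on `T = [0, 2π]` of the sections
`f(·, y)` (over all `y ∈ T`) and `f(x, ·)` (over all `x ∈ T`) are uniformly bounded. -/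
def IsPBV (f : ℝ × ℝ → ℝ) : Prop :=
  (⨆ y ∈ Icc 0 (2 * π), eVariationOn (fun x => f (x, y)) (Icc 0 (2 * π))) +
    (⨆ x ∈ Icc 0 (2 * π), eVariationOn (fun y => f (x, y)) (Icc 0 (2 * π))) < ⊤

/-- The double trigonometric Fourier coefficient
`(1 / 4π²) ∫∫_{[0,2π]²} f(x, y) e^{-imx} e^{-iny} dx dy`. -/
def fourierCoeff₂ (f : ℝ × ℝ → ℝ) (m n : ℤ) : ℂ :=
  (1 / (4 * (π : ℂ) ^ 2)) * ∫ p in Icc 0 (2 * π) ×ˢ Icc 0 (2 * π),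
    (f p : ℂ) * Complex.exp (-(Complex.I * m * (p.1 : ℂ))) *
      Complex.exp (-(Complex.I * n * (p.2 : ℂ)))

/-- The rectangular partial sum `S_{M,N}[f, p]` of the double Fourier series of `f`. -/
def partialSum (f : ℝ × ℝ → ℝ) (M N : ℕ) (p : ℝ × ℝ) : ℂ :=
  ∑ m ∈ Finset.Icc (-(M : ℤ)) M, ∑ n ∈ Finset.Icc (-(N : ℤ)) N,
    fourierCoeff₂ f m n * Complex.exp (Complex.I * m * (p.1 : ℂ)) *
      Complex.exp (Complex.I * n * (p.2 : ℂ))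

/-- The Cesàro numbers `A_k^a = (a + 1) ⋯ (a + k) / k!`, with `A_0^a = 1`. -/
def cesaroNumber (a : ℝ) (k : ℕ) : ℝ :=
  (∏ i ∈ Finset.range k, (a + (i + 1))) / (k.factorial : ℝ)

/-- The Cesàro `(C; a, b)` mean `σ_{n,m}^{a,b} f(p)` of the double Fourier series of `f`. -/
def cesaroMean (a b : ℝ) (f : ℝ × ℝ → ℝ) (n m : ℕ) (p : ℝ × ℝ) : ℂ :=
  (1 / (cesaroNumber a n : ℂ)) * (1 / (cesaroNumber b m : ℂ)) *
    ∑ i ∈ Finset.range (n + 1), ∑ j ∈ Finset.range (m + 1),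
      (cesaroNumber (a - 1) (n - i) : ℂ) * (cesaroNumber (b - 1) (m - j) : ℂ) *
        partialSum f i j p

/-- `(C; a, b)` summability at the point `p` of the double Fourier series of `f` to `L`:
`σ_{n,m}^{a,b} f(p) → L` as `n, m → ∞` independently of each other. -/
def CesaroSummableAt (a b : ℝ) (f : ℝ × ℝ → ℝ) (p : ℝ × ℝ) (L : ℝ) : Prop :=
  Tendsto (fun nm : ℕ × ℕ => cesaroMean a b f nm.1 nm.2 p) (atTop ×ˢ atTop) (𝓝 (L : ℂ))

/-- `(C; a, b)` summability of the double Fourier series of `f` to `f`, uniformly on `K`. -/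
def CesaroSummableUniformlyOn (a b : ℝ) (f : ℝ × ℝ → ℝ) (K : Set (ℝ × ℝ)) : Prop :=
  TendstoUniformlyOn (fun (nm : ℕ × ℕ) p => cesaroMean a b f nm.1 nm.2 p)
    (fun p => (f p : ℂ)) (atTop ×ˢ atTop) K

/-- The four open coordinate quadrant limits of `f` at `(x, y)` exist:
`f(x+0, y+0) = q₁`, `f(x+0, y-0) = q₂`, `f(x-0, y+0) = q₃`, `f(x-0, y-0) = q₄`. -/
def HasQuadrantLimits (f : ℝ × ℝ → ℝ) (x y q₁ q₂ q₃ q₄ : ℝ) : Prop :=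
  Tendsto f (𝓝[>] x ×ˢ 𝓝[>] y) (𝓝 q₁) ∧ Tendsto f (𝓝[>] x ×ˢ 𝓝[<] y) (𝓝 q₂) ∧
    Tendsto f (𝓝[<] x ×ˢ 𝓝[>] y) (𝓝 q₃) ∧ Tendsto f (𝓝[<] x ×ˢ 𝓝[<] y) (𝓝 q₄)

end DoubleFourier

end

/-! Summation by parts turns the Cesàro mean into the convolution of `f` with a product of two
one-dimensional kernels `cesaroKernel`. These are even and periodic, so the integral over a period
square folds into four integrals over `(0, π]²`, one for each quadrant. Each kernel has integral `π`
over `[0, π]`, so the constants `π² qᵢ` split off exactly. What remains is to show that `∫∫ g(s, t)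
k(s) l(t)` is small, where `g(s, t) = f(x ± s, y ± t) - q` is small near the origin and has sections
of bounded variation.

Put `N = n + 1`. The kernel of order `-α` satisfies `|k(s)| ≤ C N (N s)^(α-1)`, and its primitive
satisfies `|∫_s^π k| ≤ C (N s)^(α-1)` once `N s ≥ 1` (`abs_cesaroKernel_le`,
`abs_integral_cesaroKernel_le`). The first bound alone does not suffice: its integral over `(0, π]`
grows like `N^α`. The oscillation of the kernel must be used, and bounded variation allows this in
one variable at a time: by a second mean value theorem (`abs_integral_mul_le_of_eVariationOn_le`) an
integral over `t > a` costs only a constant times `(M a)^(β-1)`, where `M = m + 1`.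

In the scaled variables `u = N s`, `v = M t`, cut off the box `u, v ≤ R`
(`abs_integral_mul_kernels_le`). On the box `g` is small, and the kernel bounds have total mass
depending only on `R`. Outside it, the mean value theorem is applied in the variable whose scaled
value is the larger, and absolute values are taken in the other. This leaves `∫ u^(α-1) max(R,
u)^(β-1) du`, a constant multiple of `R^(α+β-1)`, which is finite and tends to `0` as `R → ∞`
precisely because `α + β < 1`. No mixed variation of `f` enters, and no bound depends on the point,
so pointwise and uniform convergence follow from the single estimate
`exists_norm_cesaroMean_sub_le`. -/

namespace DoubleFourier

/-! ### Abel summation and trigonometric sums -/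

/-- Abel's inequality for a nonnegative antitone weight. -/
theorem abs_sum_range_mul_le_of_antitone {a c : ℕ → ℝ} {B : ℝ} (n : ℕ)
    (ha : ∀ i j, i ≤ j → j < n → a j ≤ a i) (h0 : ∀ i < n, 0 ≤ a i)
    (hc : ∀ q ≤ n, |∑ l ∈ Finset.range q, c l| ≤ B) :
    |∑ l ∈ Finset.range n, a l * c l| ≤ B * a 0 ∨ n = 0 := by
  -- For `n = 0` nothing is assumed about `a 0`, so `B * a 0` might be negative; hence the second
  -- alternative.
  rcases Nat.eq_zero_or_pos n with h | hn
  · exact Or.inr h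
  left
  -- Partial summation as an invariant: each step adds `(a q - a (q + 1))` times a partial sum of
  -- `c`, and these weights telescope.
  have key : ∀ q, q < n → |(∑ l ∈ Finset.range (q + 1), a l * c l)
      - a q * ∑ l ∈ Finset.range (q + 1), c l| ≤ B * (a 0 - a q) := by
    intro q
    induction q with
    | zero => intro _; simp
    | succ q ih =>
      intro hq
      have h1 := ih (by omega)
      have h2 : a (q + 1) ≤ a q := ha q (q + 1) (by omega) hq
      have h3 := hc (q + 1) (by omega)
      rw [Finset.sum_range_succ _ (q + 1), Finset.sum_range_succ c (q + 1)]
      set S := ∑ l ∈ Finset.range (q + 1), a l * c l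
      set T := ∑ l ∈ Finset.range (q + 1), c l
      have : S + a (q + 1) * c (q + 1) - a (q + 1) * (T + c (q + 1))
          = (S - a q * T) + (a q - a (q + 1)) * T := by ring
      rw [this]
      refine (abs_add_le _ _).trans ?_
      rw [abs_mul, abs_of_nonneg (sub_nonneg.2 h2)]
      nlinarith [mul_le_mul_of_nonneg_left h3 (sub_nonneg.2 h2)]
  have h1 := key (n - 1) (by omega)
  have h2 := hc n le_rfl
  have h3 := h0 (n - 1) (by omega)
  rw [show n - 1 + 1 = n by omega] at h1
  have : ∑ l ∈ Finset.range n, a l * c l = (∑ l ∈ Finset.range n, a l * c l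
      - a (n - 1) * ∑ l ∈ Finset.range n, c l) + a (n - 1) * ∑ l ∈ Finset.range n, c l := by ring
  rw [this]
  refine (abs_add_le _ _).trans ?_
  rw [abs_mul, abs_of_nonneg h3]
  nlinarith [mul_le_mul_of_nonneg_left h2 h3]

theorem sin_half_ge {s : ℝ} (h0 : 0 ≤ s) (h1 : s ≤ π) : s / π ≤ Real.sin (s / 2) := by
  have := Real.mul_le_sin (x := s / 2) (by linarith) (by linarith)
  calc s / π = 2 / π * (s / 2) := by ring
    _ ≤ _ := this

/-- Multiplication by `2 sin (s / 2)` makes the sum telescope to a difference of two sines, and `sin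
(s / 2) ≥ s / π`. -/
theorem abs_sum_cos_le {s : ℝ} (h0 : 0 < s) (h1 : s ≤ π) (φ : ℝ) (q : ℕ) :
    |∑ l ∈ Finset.range q, Real.cos (φ - l * s)| ≤ π / s := by
  have hs := sin_half_ge h0.le h1
  have hp : 0 < s / π := by positivity
  have key : 2 * Real.sin (s / 2) * ∑ l ∈ Finset.range q, Real.cos (φ - l * s)
      = Real.sin (φ + s / 2) - Real.sin (φ - q * s + s / 2) := by
    induction q with
    | zero => simp
    | succ q ih =>
      rw [Finset.sum_range_succ, mul_add, ih]
      have e : 2 * Real.sin (s / 2) * Real.cos (φ - q * s)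
          = Real.sin (φ - q * s + s / 2) - Real.sin (φ - q * s - s / 2) := by
        generalize φ - q * s = ψ
        rw [Real.sin_add, Real.sin_sub]; ring
      rw [e]; push_cast
      rw [show φ - (q + 1) * s + s / 2 = φ - q * s - s / 2 by ring]; ring
  have h2 : |2 * Real.sin (s / 2) * ∑ l ∈ Finset.range q, Real.cos (φ - l * s)| ≤ 2 := by
    rw [key]
    refine (abs_sub _ _).trans ?_
    linarith [Real.abs_sin_le_one (φ + s / 2), Real.abs_sin_le_one (φ - q * s + s / 2)]
  rw [abs_mul, abs_of_pos (by linarith : 0 < 2 * Real.sin (s / 2))] at h2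
  rw [le_div_iff₀ h0]
  have h3 : s / π * |∑ l ∈ Finset.range q, Real.cos (φ - l * s)| ≤ 1 := by
    nlinarith [mul_le_mul_of_nonneg_right hs
      (abs_nonneg (∑ l ∈ Finset.range q, Real.cos (φ - l * s)))]
  rw [div_mul_eq_mul_div, div_le_one Real.pi_pos] at h3
  linarith

/-- A cosine sum with weights that are antitone from the index `L` on. -/
theorem abs_sum_mul_cos_le {s : ℝ} (h0 : 0 < s) (h1 : s ≤ π) (φ : ℝ) {a : ℕ → ℝ} (n L : ℕ)
    (ha : ∀ i j, i ≤ j → j < n → a j ≤ a i) (hn : ∀ i < n, 0 ≤ a i) (hL : 0 ≤ a L) :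
    |∑ l ∈ Finset.range n, a l * Real.cos (φ - l * s)|
      ≤ ∑ l ∈ Finset.range (min L n), a l + π / s * a L := by
  have hps : 0 ≤ π / s := by have := Real.pi_pos; positivity
  have hsum : ∀ k ≤ n, |∑ l ∈ Finset.range k, a l * Real.cos (φ - l * s)|
      ≤ ∑ l ∈ Finset.range k, a l := by
    intro k hk
    refine (Finset.abs_sum_le_sum_abs _ _).trans (Finset.sum_le_sum fun l hl => ?_)
    have := hn l (by have := Finset.mem_range.1 hl; omega)
    rw [abs_mul, abs_of_nonneg this]
    exact mul_le_of_le_one_right this (Real.abs_cos_le_one _)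
  -- Terms before `L` are bounded trivially; Abel's inequality handles the weights from `L` on.
  rcases le_or_gt n L with h | h
  · rw [min_eq_right h]
    have := hsum n le_rfl
    have : 0 ≤ π / s * a L := by positivity
    linarith
  rw [min_eq_left h.le]
  obtain ⟨k, rfl⟩ := Nat.exists_eq_add_of_le h.le
  rw [Finset.sum_range_add]
  refine (abs_add_le _ _).trans (add_le_add (hsum L (by omega)) ?_)
  have := abs_sum_range_mul_le_of_antitone (a := fun i => a (L + i))
    (c := fun i => Real.cos (φ - (L + i : ℕ) * s)) (B := π / s) k
    (fun i j hij hj => ha _ _ (by omega) (by omega)) (fun i hi => hn _ (by omega)) ?_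
  · rcases this with h | h
    · simpa using h
    · omega
  · intro q _
    have := abs_sum_cos_le h0 h1 (φ - L * s) q
    convert this using 4
    push_cast; ring_nf

/-! ### Cesàro numbers of negative order -/

theorem cesaroNumber_zero (a : ℝ) : cesaroNumber a 0 = 1 := by simp [cesaroNumber]

theorem cesaroNumber_succ (a : ℝ) (k : ℕ) :
    cesaroNumber a (k + 1) = cesaroNumber a k * (1 + a / (k + 1)) := by
  have : (k.factorial : ℝ) ≠ 0 := by positivity
  have : (k : ℝ) + 1 ≠ 0 := by positivity
  simp only [cesaroNumber, Finset.prod_range_succ, Nat.factorial_succ]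
  push_cast
  field_simp
  ring

theorem cesaroNumber_order_zero (k : ℕ) : cesaroNumber 0 k = 1 := by
  induction k with
  | zero => exact cesaroNumber_zero 0
  | succ k ih => rw [cesaroNumber_succ, ih]; simp

theorem cesaroNumber_sub_one (a : ℝ) (k : ℕ) :
    cesaroNumber (a - 1) (k + 1) = cesaroNumber a (k + 1) - cesaroNumber a k := by
  induction k with
  | zero => rw [cesaroNumber_succ, cesaroNumber_succ, cesaroNumber_zero, cesaroNumber_zero]; simp
  | succ k ih =>
    rw [cesaroNumber_succ (a - 1), ih, cesaroNumber_succ a (k + 1), cesaroNumber_succ a k]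
    push_cast
    field_simp
    ring

section Neg

variable {α : ℝ}

theorem cesaroNumber_neg_pos (h1 : α < 1) (k : ℕ) : 0 < cesaroNumber (-α) k := by
  induction k with
  | zero => simp [cesaroNumber_zero]
  | succ k ih =>
    rw [cesaroNumber_succ]
    refine mul_pos ih ?_
    have : α / (k + 1) < 1 := by
      rw [div_lt_one (by positivity)]
      have : (0 : ℝ) ≤ k := by positivity
      linarith
    rw [neg_div]; linarith

theorem cesaroNumber_neg_sub (k : ℕ) :
    cesaroNumber (-α) k - cesaroNumber (-α) (k + 1) = α * (cesaroNumber (-α) k / (k + 1)) := by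
  rw [cesaroNumber_succ]; ring

theorem cesaroNumber_neg_antitone (h0 : 0 < α) (h1 : α < 1) : Antitone (cesaroNumber (-α)) := by
  refine antitone_nat_of_succ_le fun k => ?_
  have := cesaroNumber_neg_sub (α := α) k
  have h := cesaroNumber_neg_pos h1 k
  have : 0 ≤ α * (cesaroNumber (-α) k / (k + 1)) := by positivity
  linarith

/-- The difference is `α A_k / (k + 1)`, with decreasing numerator and increasing denominator. This
convexity is what makes the slopes below monotone. -/
theorem cesaroNumber_neg_diff_antitone (h0 : 0 < α) (h1 : α < 1) :
    Antitone fun k => cesaroNumber (-α) k - cesaroNumber (-α) (k + 1) := by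
  intro i j hij
  simp only [cesaroNumber_neg_sub]
  have := cesaroNumber_neg_antitone h0 h1 hij
  have hi := cesaroNumber_neg_pos h1 i
  have : (i : ℝ) ≤ j := by exact_mod_cast hij
  gcongr

/-- With `x = 1 / (k + 1)`, the ratio of consecutive numbers is `1 - α x ≤ 1 / (1 + α x) ≤ (1 +
x)^(-α)`, the last step being Bernoulli's inequality. -/
theorem cesaroNumber_neg_le (h0 : 0 < α) (h1 : α < 1) (k : ℕ) :
    cesaroNumber (-α) k ≤ ((k : ℝ) + 1) ^ (-α) := by
  induction k with
  | zero => simp [cesaroNumber_zero]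
  | succ k ih =>
    rw [cesaroNumber_succ]
    have hk : (0 : ℝ) < k + 1 := by positivity
    have hA := cesaroNumber_neg_pos h1 k
    have hx : 0 < 1 + -α / ((k : ℝ) + 1) := by
      have := cesaroNumber_neg_pos h1 (k + 1)
      rw [cesaroNumber_succ] at this
      exact pos_of_mul_pos_right this hA.le
    have hb := rpow_one_add_le_one_add_mul_self (s := 1 / ((k : ℝ) + 1))
      (by have : 0 < 1 / ((k : ℝ) + 1) := by positivity
          linarith) h0.le h1.le
    have e : ((k : ℝ) + 1 + 1) = (k + 1) * (1 + 1 / (k + 1)) := by field_simp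
    push_cast
    rw [e, Real.mul_rpow hk.le (by positivity)]
    refine mul_le_mul ih ?_ hx.le (by positivity)
    rw [Real.rpow_neg (by positivity)]
    refine le_trans ?_ (inv_anti₀ (by positivity) hb)
    have : (1 + -α / ((k : ℝ) + 1)) * (1 + α * (1 / (k + 1))) ≤ 1 := by
      have : (1 + -α / ((k : ℝ) + 1)) * (1 + α * (1 / (k + 1))) = 1 - (α / (k + 1)) ^ 2 := by ring
      rw [this]; nlinarith [sq_nonneg (α / ((k : ℝ) + 1))]
    rwa [← one_div, le_div_iff₀ (by positivity)]

theorem le_cesaroNumber_neg (h0 : 0 < α) (h1 : α < 1) (k : ℕ) :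
    (1 - α) * ((k : ℝ) + 1) ^ (-α) ≤ cesaroNumber (-α) k := by
  -- The index is shifted so that the induction starts from the equality `A_1 = 1 - α`; the step is
  -- Bernoulli's inequality `(1 - 1/(k+2))^α ≤ 1 - α/(k+2)`.
  have key : ∀ k : ℕ, (1 - α) * ((k : ℝ) + 1) ^ (-α) ≤ cesaroNumber (-α) (k + 1) := by
    intro k
    induction k with
    | zero => simp [cesaroNumber_zero, cesaroNumber_succ]
    | succ k ih =>
      rw [cesaroNumber_succ]
      have hk : (0 : ℝ) < k + 1 := by positivity
      have hlt : 1 / ((k : ℝ) + 1 + 1) < 1 := by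
        rw [div_lt_one (by positivity)]; linarith
      have hb := rpow_one_add_le_one_add_mul_self (s := -(1 / ((k : ℝ) + 1 + 1)))
        (by linarith) h0.le h1.le
      have e : ((k : ℝ) + 1) = (k + 1 + 1) * (1 + -(1 / (k + 1 + 1))) := by field_simp; ring
      have e2 : ((k : ℝ) + 1 + 1) ^ (-α) = (k + 1) ^ (-α) * (1 + -(1 / (k + 1 + 1))) ^ α := by
        have e3 : ((k : ℝ) + 1) ^ (-α) = ((k + 1 + 1) * (1 + -(1 / (k + 1 + 1)))) ^ (-α) := by
          rw [← e]
        rw [e3, Real.mul_rpow (by positivity) (by linarith),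
          mul_assoc, ← Real.rpow_add (by linarith)]
        simp
      push_cast
      rw [e2, ← mul_assoc]
      refine mul_le_mul ih (hb.trans_eq ?_) (Real.rpow_nonneg (by linarith) _)
        (cesaroNumber_neg_pos h1 _).le
      ring
  exact (key k).trans (cesaroNumber_neg_antitone h0 h1 (by omega))

theorem sum_cesaroNumber_neg_le (h0 : 0 < α) (h1 : α < 1) (L : ℕ) :
    ∑ l ∈ Finset.range L, cesaroNumber (-α) l ≤ (L : ℝ) ^ (1 - α) / (1 - α) := by
  have h2 : 0 < 1 - α := by linarith
  rw [le_div_iff₀ h2]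
  induction L with
  | zero => simp [Real.zero_rpow h2.ne']
  | succ L ih =>
    rw [Finset.sum_range_succ, add_mul]
    have hle := cesaroNumber_neg_le h0 h1 L
    have hL : (0 : ℝ) < L + 1 := by positivity
    have hlt : 1 / ((L : ℝ) + 1) ≤ 1 := by
      rw [div_le_one hL]; linarith [(Nat.cast_nonneg L : (0 : ℝ) ≤ L)]
    have hb := rpow_one_add_le_one_add_mul_self (s := -(1 / ((L : ℝ) + 1)))
      (by linarith) h2.le (by linarith)
    have e : (L : ℝ) = (L + 1) * (1 + -(1 / (L + 1))) := by field_simp; ring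
    have e2 : (L : ℝ) ^ (1 - α) ≤ (L + 1) ^ (1 - α) - (1 - α) * (L + 1) ^ (-α) := by
      conv_lhs => rw [e]
      rw [Real.mul_rpow hL.le (by linarith)]
      have e3 : ((L : ℝ) + 1) ^ (-α) = (L + 1) ^ (1 - α) * (1 / (L + 1)) := by
        rw [show -α = (1 - α) - 1 by ring, Real.rpow_sub_one hL.ne']; ring
      rw [e3]
      have := mul_le_mul_of_nonneg_left hb (Real.rpow_nonneg hL.le (1 - α))
      linarith
    push_cast
    nlinarith [mul_le_mul_of_nonneg_right hle h2.le]

end Neg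

end DoubleFourier

namespace DoubleFourier

/-! ### Integrals against functions of bounded variation -/

theorem abs_sub_le_of_eVariationOn_le {φ : ℝ → ℝ} {s : Set ℝ} {V : ℝ}
    (hφ : eVariationOn φ s ≤ ENNReal.ofReal V) (hV : 0 ≤ V) {x y : ℝ} (hx : x ∈ s) (hy : y ∈ s) :
    |φ x - φ y| ≤ V := by
  have h := (eVariationOn.edist_le φ hx hy).trans hφ
  rw [edist_dist] at h
  exact (ENNReal.ofReal_le_ofReal_iff hV).1 h

theorem intervalIntegrable_of_eVariationOn_le {φ : ℝ → ℝ} {a b V : ℝ} (hab : a ≤ b)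
    (hφ : eVariationOn φ (Icc a b) ≤ ENNReal.ofReal V) : IntervalIntegrable φ volume a b := by
  have hb : BoundedVariationOn φ (Icc a b) := ne_top_of_le_ne_top ENNReal.ofReal_ne_top hφ
  obtain ⟨p, q, hp, hq, rfl⟩ := hb.locallyBoundedVariationOn.exists_monotoneOn_sub_monotoneOn
  rw [← uIcc_of_le hab] at hp hq
  exact hp.intervalIntegrable.sub hq.intervalIntegrable

/-- Summation by parts. In use, `G k` is the integral of a kernel from the `k`-th partition point to
the right end, whence `G n = 0`. -/
theorem abs_sum_mul_sub_le (φ G : ℕ → ℝ) {B V : ℝ} (n : ℕ)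
    (hG : ∀ k ≤ n, |G k| ≤ B) (hn : G n = 0)
    (hV : ∑ k ∈ Finset.range n, |φ (k + 1) - φ k| ≤ V) :
    |∑ k ∈ Finset.range n, φ k * (G k - G (k + 1))| ≤ B * (|φ 0| + V) := by
  have key : ∀ q, ∑ k ∈ Finset.range q, φ k * (G k - G (k + 1))
      = φ 0 * G 0 - φ q * G q + ∑ k ∈ Finset.range q, (φ (k + 1) - φ k) * G (k + 1) := by
    intro q
    induction q with
    | zero => simp
    | succ q ih => rw [Finset.sum_range_succ, ih, Finset.sum_range_succ]; ring
  rw [key, hn, mul_zero, sub_zero, mul_add]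
  refine (abs_add_le _ _).trans (add_le_add ?_ ?_)
  · rw [abs_mul, mul_comm]
    exact mul_le_mul_of_nonneg_right (hG 0 (Nat.zero_le _)) (abs_nonneg _)
  · have hB : 0 ≤ B := (abs_nonneg _).trans (hG 0 (Nat.zero_le _))
    refine (Finset.abs_sum_le_sum_abs _ _).trans ?_
    calc ∑ k ∈ Finset.range n, |(φ (k + 1) - φ k) * G (k + 1)|
        ≤ ∑ k ∈ Finset.range n, B * |φ (k + 1) - φ k| := by
          refine Finset.sum_le_sum fun k hk => ?_
          rw [abs_mul, mul_comm]
          exact mul_le_mul_of_nonneg_right (hG _ (Finset.mem_range.1 hk)) (abs_nonneg _)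
      _ = B * ∑ k ∈ Finset.range n, |φ (k + 1) - φ k| := by rw [Finset.mul_sum]
      _ ≤ B * V := mul_le_mul_of_nonneg_left hV hB

/-- A form of the second mean value theorem for functions of bounded variation. -/
theorem abs_integral_mul_le_of_eVariationOn_le {φ K : ℝ → ℝ} {a b V B : ℝ} (hab : a ≤ b)
    (hK : Continuous K) (hV : 0 ≤ V) (hφ : eVariationOn φ (Icc a b) ≤ ENNReal.ofReal V)
    (hB : ∀ u ∈ Icc a b, |∫ t in u..b, K t| ≤ B) :
    |∫ t in a..b, φ t * K t| ≤ B * (|φ a| + V) := by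
  obtain ⟨M, hM⟩ := isCompact_Icc.exists_bound_of_continuousOn (s := Icc a b) hK.continuousOn
  have hM0 : 0 ≤ M := (norm_nonneg _).trans (hM a (left_mem_Icc.2 hab))
  have hint := intervalIntegrable_of_eVariationOn_le hab hφ
  have hKi : ∀ u v, IntervalIntegrable K volume u v := fun u v => hK.intervalIntegrable u v
  -- On a uniform partition with `n + 1` cells, `φ` is replaced by its value at the left end of each
  -- cell. The error is at most `M h` times the sum of the variations on the cells, hence `O(h)`
  -- without any continuity of `φ`; the step function is treated by summation by parts.
  have main : ∀ n : ℕ, |∫ t in a..b, φ t * K t|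
      ≤ M * (b - a) * V * (1 / ((n : ℝ) + 1)) + B * (|φ a| + V) := by
    intro n
    set N : ℝ := (n : ℝ) + 1 with hN
    have hN0 : 0 < N := by positivity
    set h : ℝ := (b - a) / N with hh
    have hh0 : 0 ≤ h := div_nonneg (sub_nonneg.2 hab) hN0.le
    set x : ℕ → ℝ := fun k => a + k * h with hx
    have hxm : Monotone x := by
      intro i j hij
      have : (i : ℝ) ≤ j := by exact_mod_cast hij
      simp only [hx]; gcongr
    have hx0 : x 0 = a := by simp [hx]
    have hxn : x (n + 1) = b := by simp only [hx, hh]; push_cast; rw [← hN]; field_simp; ring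
    have hstep : ∀ k, x (k + 1) - x k = h := by intro k; simp only [hx]; push_cast; ring
    have hmem : ∀ k ≤ n + 1, x k ∈ Icc a b := fun k hk =>
      ⟨hx0 ▸ hxm (Nat.zero_le k), hxn ▸ hxm hk⟩
    have hsub : ∀ k ∈ Finset.range (n + 1), Icc (x k) (x (k + 1)) ⊆ Icc a b := fun k hk =>
      Icc_subset_Icc (hmem k (Finset.mem_range.1 hk).le).1 (hmem (k + 1) (Finset.mem_range.1 hk)).2
    have hsubI : ∀ k ∈ Finset.range (n + 1), IntervalIntegrable φ volume (x k) (x (k + 1)) := by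
      intro k hk
      refine hint.mono_set ?_
      rw [uIcc_of_le hab, uIcc_of_le (hxm (Nat.le_succ k))]
      exact hsub k hk
    set v : ℕ → ℝ := fun k => (eVariationOn φ (Icc (x k) (x (k + 1)))).toReal with hv
    have hfin : ∀ k ∈ Finset.range (n + 1), eVariationOn φ (Icc (x k) (x (k + 1))) ≠ ⊤ :=
      fun k hk => ne_top_of_le_ne_top ENNReal.ofReal_ne_top
        ((eVariationOn.mono φ (hsub k hk)).trans hφ)
    have hv0 : ∀ k, 0 ≤ v k := fun k => ENNReal.toReal_nonneg
    have hvs : ∑ k ∈ Finset.range (n + 1), v k ≤ V := by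
      rw [← ENNReal.toReal_sum hfin, eVariationOn.sum' φ hxm, hx0, hxn]
      exact ENNReal.toReal_le_of_le_ofReal hV hφ
    have hosc : ∀ k ∈ Finset.range (n + 1), ∀ t ∈ Icc (x k) (x (k + 1)),
        |φ t - φ (x k)| ≤ v k := fun k hk t ht =>
      abs_sub_le_of_eVariationOn_le (ENNReal.ofReal_toReal (hfin k hk)).ge (hv0 k) ht
        (left_mem_Icc.2 (hxm (Nat.le_succ k)))
    set G : ℕ → ℝ := fun k => ∫ t in x k..b, K t with hG
    have hsplit : ∫ t in a..b, φ t * K t = ∑ k ∈ Finset.range (n + 1),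
        ((∫ t in x k..x (k + 1), (φ t - φ (x k)) * K t) + φ (x k) * (G k - G (k + 1))) := by
      rw [← hx0, ← hxn, ← intervalIntegral.sum_integral_adjacent_intervals (n := n + 1)
        (fun k hk => (hsubI k (Finset.mem_range.2 hk)).mul_continuousOn hK.continuousOn)]
      refine Finset.sum_congr rfl fun k hk => ?_
      have e1 : G k - G (k + 1) = ∫ t in x k..x (k + 1), K t := by
        simp only [hG]
        rw [sub_eq_iff_eq_add, intervalIntegral.integral_add_adjacent_intervals (hKi _ _) (hKi _ _)]
      rw [e1, ← intervalIntegral.integral_const_mul, ← intervalIntegral.integral_add]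
      · refine intervalIntegral.integral_congr fun t _ => ?_
        ring
      · exact ((hsubI k hk).sub intervalIntegrable_const).mul_continuousOn hK.continuousOn
      · exact (hKi _ _).const_mul _
    rw [hsplit, Finset.sum_add_distrib]
    refine (abs_add_le _ _).trans (add_le_add ?_ ?_)
    · refine (Finset.abs_sum_le_sum_abs _ _).trans ?_
      calc ∑ k ∈ Finset.range (n + 1), |∫ t in x k..x (k + 1), (φ t - φ (x k)) * K t|
          ≤ ∑ k ∈ Finset.range (n + 1), M * h * v k := by
            refine Finset.sum_le_sum fun k hk => ?_
            have := intervalIntegral.norm_integral_le_of_norm_le_const (a := x k) (b := x (k + 1))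
              (f := fun t => (φ t - φ (x k)) * K t) (C := v k * M) fun t ht => by
                rw [uIoc_of_le (hxm (Nat.le_succ k))] at ht
                have ht' := Ioc_subset_Icc_self ht
                rw [norm_mul]
                exact mul_le_mul (hosc k hk t ht') (hM t (hsub k hk ht')) (norm_nonneg _) (hv0 k)
            rw [hstep, abs_of_nonneg hh0] at this
            calc _ ≤ _ := this
              _ = _ := by ring
        _ = M * h * ∑ k ∈ Finset.range (n + 1), v k := by rw [Finset.mul_sum]
        _ ≤ M * h * V := mul_le_mul_of_nonneg_left hvs (mul_nonneg hM0 hh0)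
        _ = _ := by rw [hh]; ring
    · rw [← hx0]
      refine abs_sum_mul_sub_le (fun k => φ (x k)) G (n + 1) (fun k hk => hB _ (hmem k hk)) ?_ ?_
      · simp only [hG, hxn, intervalIntegral.integral_same]
      · refine le_trans (Finset.sum_le_sum fun k hk => ?_) hvs
        exact hosc k hk _ (right_mem_Icc.2 (hxm (Nat.le_succ k)))
  have hlim := (tendsto_one_div_add_atTop_nhds_zero_nat (𝕜 := ℝ)).const_mul (M * (b - a) * V)
  have hlim' := hlim.add_const (B * (|φ a| + V))
  rw [mul_zero, zero_add] at hlim'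
  exact ge_of_tendsto' hlim' main

end DoubleFourier

noncomputable section

namespace DoubleFourier

/-! ### The Cesàro kernel of negative order -/

/-- The kernel `1 + 2 ∑_{k = 1}^n (A_{n-k}^a / A_n^a) cos (k s)` of the `(C; a)` means,
with summation index `l = n - k`. -/
def cesaroKernel (a : ℝ) (n : ℕ) (s : ℝ) : ℝ :=
  1 + 2 / cesaroNumber a n *
    ∑ l ∈ Finset.range n, cesaroNumber a l * Real.cos (n * s - l * s)

theorem continuous_cesaroKernel (a : ℝ) (n : ℕ) : Continuous (cesaroKernel a n) := by
  unfold cesaroKernel; fun_prop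

theorem cesaroKernel_neg (a : ℝ) (n : ℕ) (s : ℝ) : cesaroKernel a n (-s) = cesaroKernel a n s := by
  unfold cesaroKernel
  congr 2
  refine Finset.sum_congr rfl fun l _ => ?_
  rw [← Real.cos_neg]; ring_nf

theorem cesaroKernel_periodic (a : ℝ) (n : ℕ) : Function.Periodic (cesaroKernel a n) (2 * π) := by
  intro s
  unfold cesaroKernel
  congr 2
  refine Finset.sum_congr rfl fun l hl => ?_
  have hl' := (Finset.mem_range.1 hl).le
  have := Real.cos_add_nat_mul_two_pi (n * s - l * s) (n - l)
  rw [Nat.cast_sub hl'] at this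
  rw [← this]; ring_nf

theorem integral_cesaroKernel_eq (a : ℝ) (n : ℕ) (u : ℝ) :
    ∫ s in u..π, cesaroKernel a n s = π - u - 2 / cesaroNumber a n *
      ∑ l ∈ Finset.range n, cesaroNumber a l / ((n : ℝ) - l) * Real.sin (n * u - l * u) := by
  unfold cesaroKernel
  have hcos : ∀ l ∈ Finset.range n, ∫ s in u..π, cesaroNumber a l * Real.cos (n * s - l * s)
      = -(cesaroNumber a l / ((n : ℝ) - l) * Real.sin (n * u - l * u)) := by
    intro l hl
    have hl' := Finset.mem_range.1 hl
    have hne : (n : ℝ) - l ≠ 0 := by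
      have : (l : ℝ) < n := by exact_mod_cast hl'
      linarith
    simp_rw [← sub_mul]
    rw [intervalIntegral.integral_const_mul, intervalIntegral.integral_comp_mul_left _ hne,
      integral_cos]
    have : Real.sin (((n : ℝ) - l) * π) = 0 := by
      rw [← Nat.cast_sub hl'.le]; exact Real.sin_nat_mul_pi _
    rw [this, smul_eq_mul]; ring
  rw [intervalIntegral.integral_add (by simp) (Continuous.intervalIntegrable (by fun_prop) _ _),
    intervalIntegral.integral_const_mul, intervalIntegral.integral_finsetSum
      (fun l _ => Continuous.intervalIntegrable (by fun_prop) _ _),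
    Finset.sum_congr rfl hcos, Finset.sum_neg_distrib]
  simp
  ring

theorem integral_cesaroKernel_zero_pi (a : ℝ) (n : ℕ) : ∫ s in 0..π, cesaroKernel a n s = π := by
  rw [integral_cesaroKernel_eq]; simp

/-! ### Size of the kernel of negative order and of its primitive -/

section Neg

variable {α : ℝ}

/-- The cut at `L = ⌊1 / s⌋` balances the two bounds: `∑_{l < L} A_l` is of order `L^(1-α)`, while
the oscillating tail costs `A_L / s` with `A_L ≤ s^α`. -/
theorem abs_sum_cesaroNumber_mul_cos_le (h0 : 0 < α) (h1 : α < 1) {s : ℝ} (hs0 : 0 < s)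
    (hs1 : s ≤ π) (n : ℕ) (φ : ℝ) :
    |∑ l ∈ Finset.range n, cesaroNumber (-α) l * Real.cos (φ - l * s)|
      ≤ (1 / (1 - α) + π) * s ^ (α - 1) := by
  have h2 : 0 < 1 - α := by linarith
  set L := ⌊1 / s⌋₊
  have hA := cesaroNumber_neg_antitone h0 h1
  have hp := fun k => (cesaroNumber_neg_pos h1 k).le
  refine (abs_sum_mul_cos_le hs0 hs1 φ n L (fun i j hij _ => hA hij) (fun i _ => hp i)
    (hp L)).trans ?_
  have e1 : ∑ l ∈ Finset.range (min L n), cesaroNumber (-α) l ≤ s ^ (α - 1) / (1 - α) := by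
    calc _ ≤ ∑ l ∈ Finset.range L, cesaroNumber (-α) l :=
          Finset.sum_le_sum_of_subset_of_nonneg (Finset.range_mono (min_le_left _ _))
            fun i _ _ => hp i
      _ ≤ (L : ℝ) ^ (1 - α) / (1 - α) := sum_cesaroNumber_neg_le h0 h1 L
      _ ≤ (1 / s) ^ (1 - α) / (1 - α) := by
          gcongr
          exact Nat.floor_le (by positivity)
      _ = _ := by
          rw [one_div, Real.inv_rpow hs0.le, ← Real.rpow_neg hs0.le, neg_sub]
  have e2 : π / s * cesaroNumber (-α) L ≤ π * s ^ (α - 1) := by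
    have hle : cesaroNumber (-α) L ≤ s ^ α := by
      refine (cesaroNumber_neg_le h0 h1 L).trans ?_
      have : s ^ α = (1 / s) ^ (-α) := by
        rw [one_div, Real.inv_rpow hs0.le, Real.rpow_neg hs0.le, inv_inv]
      rw [this]
      exact Real.rpow_le_rpow_of_nonpos (by positivity) (Nat.lt_floor_add_one _).le (by linarith)
    calc _ ≤ π / s * s ^ α := by have := Real.pi_pos; gcongr
      _ = _ := by rw [Real.rpow_sub_one hs0.ne']; ring
  calc _ ≤ s ^ (α - 1) / (1 - α) + π * s ^ (α - 1) := add_le_add e1 e2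
    _ = _ := by ring

theorem inv_cesaroNumber_neg_le (h0 : 0 < α) (h1 : α < 1) (n : ℕ) :
    1 / cesaroNumber (-α) n ≤ 1 / (1 - α) * ((n : ℝ) + 1) ^ α := by
  have h2 : 0 < 1 - α := by linarith
  have hN : 0 < ((n : ℝ) + 1) ^ α := by positivity
  have h := le_cesaroNumber_neg h0 h1 n
  rw [Real.rpow_neg (by positivity)] at h
  rw [div_le_iff₀ (cesaroNumber_neg_pos h1 n)]
  calc (1 : ℝ) = 1 / (1 - α) * ((n : ℝ) + 1) ^ α * ((1 - α) * (((n : ℝ) + 1) ^ α)⁻¹) := by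
        field_simp
    _ ≤ _ := mul_le_mul_of_nonneg_left h (by positivity)

theorem mul_mul_rpow_sub_one {N s : ℝ} (hN : 0 < N) (hs : 0 ≤ s) :
    N * (N * s) ^ (α - 1) = N ^ α * s ^ (α - 1) := by
  rw [Real.mul_rpow hN.le hs, Real.rpow_sub_one hN.ne']; field_simp

theorem abs_cesaroKernel_le (h0 : 0 < α) (h1 : α < 1) {s : ℝ} (hs0 : 0 < s) (hs1 : s ≤ π) (n : ℕ) :
    |cesaroKernel (-α) n s| ≤ (π + 2 / (1 - α) * (1 / (1 - α) + π)) *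
      (((n : ℝ) + 1) * (((n : ℝ) + 1) * s) ^ (α - 1)) := by
  have h2 : 0 < 1 - α := by linarith
  have hN : (0 : ℝ) < (n : ℝ) + 1 := by positivity
  have hpi := Real.pi_pos
  rw [mul_mul_rpow_sub_one hN hs0.le]
  unfold cesaroKernel
  refine (abs_add_le _ _).trans ?_
  rw [add_mul]
  refine add_le_add ?_ ?_
  -- The constant term is absorbed, since `N^α ≥ 1` and `π s^(α-1) ≥ 1` on `(0, π]`.
  · rw [abs_one]
    have e1 : 1 ≤ ((n : ℝ) + 1) ^ α := Real.one_le_rpow (by linarith [(Nat.cast_nonneg n : (0:ℝ) ≤ n)]) h0.le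
    have e2 : 1 ≤ (s / π) ^ (α - 1) :=
      Real.one_le_rpow_of_pos_of_le_one_of_nonpos (by positivity) (by rwa [div_le_one hpi])
        (by linarith)
    have e3 : (s / π) ^ (α - 1) ≤ s ^ (α - 1) * π := by
      rw [Real.div_rpow hs0.le hpi.le, div_eq_mul_inv, ← Real.rpow_neg hpi.le]
      have : π ^ (-(α - 1)) ≤ π ^ (1 : ℝ) :=
        Real.rpow_le_rpow_of_exponent_le (by linarith [Real.pi_gt_three]) (by linarith)
      rw [Real.rpow_one] at this
      gcongr
    calc (1 : ℝ) ≤ 1 * (s ^ (α - 1) * π) := by linarith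
      _ ≤ ((n : ℝ) + 1) ^ α * (s ^ (α - 1) * π) := by gcongr
      _ = _ := by ring
  · have hA := cesaroNumber_neg_pos h1 n
    rw [abs_mul, abs_of_pos (by positivity)]
    calc _ ≤ 2 * (1 / (1 - α) * ((n : ℝ) + 1) ^ α) * ((1 / (1 - α) + π) * s ^ (α - 1)) := by
          refine mul_le_mul ?_ (abs_sum_cesaroNumber_mul_cos_le h0 h1 hs0 hs1 n _)
            (abs_nonneg _) (by positivity)
          have := inv_cesaroNumber_neg_le h0 h1 n
          calc 2 / cesaroNumber (-α) n = 2 * (1 / cesaroNumber (-α) n) := by ring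
            _ ≤ _ := by linarith
      _ = _ := by ring

/-- The Dirichlet kernel. -/
theorem two_mul_sum_cos (n : ℕ) (u : ℝ) :
    Real.sin (u / 2) * (1 + 2 * ∑ l ∈ Finset.range n, Real.cos (n * u - l * u))
      = Real.sin ((n + 1 / 2) * u) := by
  have key : ∀ q : ℕ, 2 * Real.sin (u / 2) * ∑ l ∈ Finset.range q, Real.cos (n * u - l * u)
      = Real.sin ((n + 1 / 2) * u) - Real.sin ((n + 1 / 2) * u - q * u) := by
    intro q
    induction q with
    | zero => simp
    | succ q ih =>
      rw [Finset.sum_range_succ, mul_add, ih]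
      have e1 : (n + 1 / 2) * u - q * u = (n * u - q * u) + u / 2 := by ring
      have e2 : (n + 1 / 2) * u - (q + 1 : ℕ) * u = (n * u - q * u) - u / 2 := by push_cast; ring
      rw [e1, e2]
      generalize (n * u - q * u) = ψ
      rw [Real.sin_add ψ, Real.sin_sub]; ring
  have := key n
  rw [show (n + 1 / 2) * u - n * u = u / 2 by ring] at this
  linarith

/-- The left side is the integral over `[s, π]` of the Dirichlet kernel `sin ((n + 1/2) u) / sin (u
/ 2)`. The factor `1 / sin (u / 2)` is monotone and at most `π / s`, and integrals of the sine are
at most `2 / (n + 1/2)`. -/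
theorem abs_integral_dirichlet_le {s : ℝ} (hs0 : 0 < s) (hs1 : s ≤ π) (n : ℕ) :
    |π - s - 2 * ∑ l ∈ Finset.range n, 1 / ((n : ℝ) - l) * Real.sin (n * s - l * s)|
      ≤ 8 * π / (((n : ℝ) + 1) * s) := by
  have hpi := Real.pi_pos
  have hc : (0 : ℝ) < (n : ℝ) + 1 / 2 := by positivity
  have e0 : ∫ u in s..π, cesaroKernel 0 n u
      = π - s - 2 * ∑ l ∈ Finset.range n, 1 / ((n : ℝ) - l) * Real.sin (n * s - l * s) := by
    rw [integral_cesaroKernel_eq]; simp [cesaroNumber_order_zero]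
  have e1 : ∀ u ∈ uIcc s π, cesaroKernel 0 n u
      = -((-(1 / Real.sin (u / 2))) * Real.sin ((n + 1 / 2) * u)) := by
    intro u hu
    rw [uIcc_of_le hs1] at hu
    have hu0 : 0 < u := hs0.trans_le hu.1
    have : 0 < Real.sin (u / 2) :=
      lt_of_lt_of_le (by positivity) (sin_half_ge hu0.le hu.2)
    rw [← two_mul_sum_cos]
    simp only [cesaroKernel, cesaroNumber_order_zero]
    field_simp
  rw [← e0, intervalIntegral.integral_congr e1, intervalIntegral.integral_neg, abs_neg]
  have hmono : MonotoneOn (fun u => -(1 / Real.sin (u / 2))) (Icc s π) := by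
    intro u hu v hv huv
    have hu0 : 0 < u := hs0.trans_le hu.1
    have : 0 < Real.sin (u / 2) :=
      lt_of_lt_of_le (by positivity) (sin_half_ge hu0.le hu.2)
    have h2 : Real.sin (u / 2) ≤ Real.sin (v / 2) :=
      Real.sin_le_sin_of_le_of_le_pi_div_two (by linarith) (by linarith [hv.2]) (by linarith)
    simp only [neg_le_neg_iff]
    gcongr
  have hsin : s / π ≤ Real.sin (s / 2) := sin_half_ge hs0.le hs1
  have hbd : 1 / Real.sin (s / 2) ≤ π / s := by
    rw [div_le_div_iff₀ (lt_of_lt_of_le (by positivity) hsin) hs0]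
    rw [div_le_iff₀ hpi] at hsin
    linarith
  have hpos : 0 < 1 / Real.sin (s / 2) := by
    have := lt_of_lt_of_le (by positivity) hsin
    positivity
  have hvar := (hmono.eVariationOn_eq (left_mem_Icc.2 hs1) (right_mem_Icc.2 hs1)).le
  rw [Icc_inter_Icc, max_self, min_self] at hvar
  have hV : eVariationOn (fun u => -(1 / Real.sin (u / 2))) (Icc s π)
      ≤ ENNReal.ofReal (π / s) := by
    refine hvar.trans (ENNReal.ofReal_le_ofReal ?_)
    rw [Real.sin_pi_div_two]; linarith
  have := abs_integral_mul_le_of_eVariationOn_le (K := fun u => Real.sin ((n + 1 / 2) * u))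
    (B := 2 / ((n : ℝ) + 1 / 2)) hs1 (by fun_prop) (by positivity) hV ?_
  · refine this.trans ?_
    rw [abs_neg, abs_of_pos hpos]
    have hle : 2 / ((n : ℝ) + 1 / 2) ≤ 4 / ((n : ℝ) + 1) := by
      rw [div_le_div_iff₀ hc (by positivity)]; linarith [(Nat.cast_nonneg n : (0:ℝ) ≤ n)]
    calc _ ≤ 4 / ((n : ℝ) + 1) * (π / s + π / s) := by gcongr
      _ = _ := by field_simp; ring
  · intro u _
    rw [intervalIntegral.integral_comp_mul_left _ hc.ne', integral_sin, smul_eq_mul, abs_mul,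
      abs_of_pos (inv_pos.2 hc)]
    rw [div_eq_mul_inv, mul_comm]
    refine mul_le_mul_of_nonneg_right ?_ (inv_pos.2 hc).le
    refine (abs_sub _ _).trans ?_
    linarith [Real.abs_cos_le_one ((n + 1 / 2) * u), Real.abs_cos_le_one ((n + 1 / 2) * π)]

/-- The slopes `(A_l - A_n) / (n - l)` decrease, by convexity of the Cesàro numbers. -/
theorem cesaroNumber_neg_slope_antitone (h0 : 0 < α) (h1 : α < 1) (n : ℕ) :
    ∀ i j, i ≤ j → j < n →
      (cesaroNumber (-α) j - cesaroNumber (-α) n) / ((n : ℝ) - j)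
        ≤ (cesaroNumber (-α) i - cesaroNumber (-α) n) / ((n : ℝ) - i) := by
  have hd := cesaroNumber_neg_diff_antitone h0 h1
  -- A telescoping sum of decreasing differences is at most its length times the first of them.
  have htel : ∀ i k, cesaroNumber (-α) i - cesaroNumber (-α) (i + k)
      ≤ k * (cesaroNumber (-α) i - cesaroNumber (-α) (i + 1)) := by
    intro i k
    induction k with
    | zero => simp
    | succ k ih =>
      have := hd (show i ≤ i + k by omega)
      simp only at this
      push_cast
      rw [← add_assoc]
      linarith
  have hstep : ∀ i, i + 1 < n →
      (cesaroNumber (-α) (i + 1) - cesaroNumber (-α) n) / ((n : ℝ) - (i + 1 : ℕ))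
        ≤ (cesaroNumber (-α) i - cesaroNumber (-α) n) / ((n : ℝ) - i) := by
    intro i hi
    obtain ⟨k, rfl⟩ := Nat.exists_eq_add_of_lt hi
    have h := htel (i + 1) (k + 1)
    have hd' := hd (show i ≤ i + 1 by omega)
    simp only at hd'
    rw [show i + 1 + (k + 1) = i + 1 + k + 1 by ring] at h
    have p1 : ((i + 1 + k + 1 : ℕ) : ℝ) - (i + 1 : ℕ) = k + 1 := by push_cast; ring
    have p2 : ((i + 1 + k + 1 : ℕ) : ℝ) - i = k + 2 := by push_cast; ring
    rw [p1, p2, div_le_div_iff₀ (by positivity) (by positivity)]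
    push_cast at h
    have := mul_le_mul_of_nonneg_left hd' (by positivity : (0 : ℝ) ≤ k + 1)
    nlinarith
  intro i j hij
  induction j, hij using Nat.le_induction with
  | base => intro _; exact le_rfl
  | succ j _ ih => intro hj; exact (hstep j hj).trans (ih (by omega))

theorem abs_sum_slope_mul_sin_le (h0 : 0 < α) (h1 : α < 1) {s : ℝ} (hs0 : 0 < s) (hs1 : s ≤ π)
    (n : ℕ) (hns : 1 ≤ ((n : ℝ) + 1) * s) :
    |∑ l ∈ Finset.range n, (cesaroNumber (-α) l - cesaroNumber (-α) n) / ((n : ℝ) - l) *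
      Real.sin (n * s - l * s)| ≤ 4 * (1 / (1 - α) + 2 * π) * s ^ (α - 1) / ((n : ℝ) + 1) := by
  have hpi := Real.pi_pos
  have h2 : 0 < 1 - α := by linarith
  have hA := cesaroNumber_neg_antitone h0 h1
  have hp := fun k => (cesaroNumber_neg_pos h1 k).le
  have hN : (0 : ℝ) < (n : ℝ) + 1 := by positivity
  rcases Nat.eq_zero_or_pos n with rfl | hn
  · simp only [Finset.range_zero, Finset.sum_empty, abs_zero]; positivity
  have hn1 : (1 : ℝ) ≤ n := by exact_mod_cast hn
  set b : ℕ → ℝ := fun l => (cesaroNumber (-α) l - cesaroNumber (-α) n) / ((n : ℝ) - l) with hb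
  -- The cap `n / 2` keeps `n - l ≥ (n + 1) / 4` for `l ≤ L`, so that slopes are comparable to `A_l
  -- / (n + 1)`. When the cap is active, `(n + 1) s ≥ 1` still gives `L + 1 ≥ 1 / (2 s)`.
  set L := min ⌊1 / s⌋₊ (n / 2) with hL
  have hLn : (L : ℝ) ≤ n / 2 := by
    calc (L : ℝ) ≤ (n / 2 : ℕ) := by exact_mod_cast min_le_right _ _
      _ ≤ _ := Nat.cast_div_le
  have hLs : (L : ℝ) ≤ 1 / s := by
    calc (L : ℝ) ≤ (⌊1 / s⌋₊ : ℕ) := by exact_mod_cast min_le_left _ _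
      _ ≤ _ := Nat.floor_le (by positivity)
  have hLl : 1 / (2 * s) ≤ (L : ℝ) + 1 := by
    rcases min_choice ⌊1 / s⌋₊ (n / 2) with h | h
    · rw [hL, h]
      have := Nat.lt_floor_add_one (1 / s)
      have h3 : 1 / (2 * s) ≤ 1 / s := by gcongr; linarith
      linarith
    · rw [hL, h]
      have : (n : ℝ) + 1 ≤ 2 * ((n / 2 : ℕ) + 1) := by
        have : n + 1 ≤ 2 * (n / 2 + 1) := by omega
        exact_mod_cast this
      rw [div_le_iff₀ (by positivity)]
      nlinarith
  have hbn : ∀ i < n, 0 ≤ b i := fun i hi => by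
    have : (i : ℝ) < n := by exact_mod_cast hi
    exact div_nonneg (sub_nonneg.2 (hA hi.le)) (by linarith)
  have hble : ∀ l ≤ L, b l ≤ 4 / ((n : ℝ) + 1) * cesaroNumber (-α) l := by
    intro l hl
    have hl' : (l : ℝ) ≤ L := by exact_mod_cast hl
    have hpl := hp l
    have hpn := hp n
    calc b l ≤ cesaroNumber (-α) l / ((n : ℝ) - l) := by
          simp only [hb]
          exact div_le_div_of_nonneg_right (by linarith) (by linarith)
      _ ≤ cesaroNumber (-α) l / (((n : ℝ) + 1) / 4) := by gcongr; linarith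
      _ = _ := by field_simp
  have hLlt : L < n := by
    have : (L : ℝ) < n := by linarith
    exact_mod_cast this
  have hsc : ∀ l : ℕ, Real.sin (n * s - l * s) = Real.cos (n * s - π / 2 - l * s) := by
    intro l
    rw [← Real.cos_sub_pi_div_two]; ring_nf
  simp_rw [hsc]
  refine (abs_sum_mul_cos_le hs0 hs1 _ n L (cesaroNumber_neg_slope_antitone h0 h1 n) hbn
    (hbn L hLlt)).trans ?_
  rw [min_eq_left hLlt.le]
  have e1 : ∑ l ∈ Finset.range L, b l ≤ 4 / ((n : ℝ) + 1) * (s ^ (α - 1) / (1 - α)) := by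
    calc _ ≤ ∑ l ∈ Finset.range L, 4 / ((n : ℝ) + 1) * cesaroNumber (-α) l :=
          Finset.sum_le_sum fun l hl => hble l (Finset.mem_range.1 hl).le
      _ = 4 / ((n : ℝ) + 1) * ∑ l ∈ Finset.range L, cesaroNumber (-α) l := by rw [Finset.mul_sum]
      _ ≤ 4 / ((n : ℝ) + 1) * ((L : ℝ) ^ (1 - α) / (1 - α)) := by
          gcongr
          exact sum_cesaroNumber_neg_le h0 h1 L
      _ ≤ 4 / ((n : ℝ) + 1) * ((1 / s) ^ (1 - α) / (1 - α)) := by gcongr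
      _ = _ := by
          rw [one_div s, Real.inv_rpow hs0.le, ← Real.rpow_neg hs0.le, neg_sub]
  have e2 : π / s * b L ≤ 4 / ((n : ℝ) + 1) * (2 * π * s ^ (α - 1)) := by
    have hle : cesaroNumber (-α) L ≤ 2 * s ^ α := by
      calc _ ≤ ((L : ℝ) + 1) ^ (-α) := cesaroNumber_neg_le h0 h1 L
        _ ≤ (1 / (2 * s)) ^ (-α) :=
          Real.rpow_le_rpow_of_nonpos (by positivity) hLl (by linarith)
        _ = 2 ^ α * s ^ α := by
          rw [one_div, Real.inv_rpow (by positivity), Real.rpow_neg (by positivity), inv_inv,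
            Real.mul_rpow (by norm_num) hs0.le]
        _ ≤ 2 * s ^ α := by
          have : (2 : ℝ) ^ α ≤ 2 ^ (1 : ℝ) :=
            Real.rpow_le_rpow_of_exponent_le (by norm_num) h1.le
          rw [Real.rpow_one] at this
          gcongr
    calc _ ≤ π / s * (4 / ((n : ℝ) + 1) * (2 * s ^ α)) := by
          gcongr
          exact (hble L le_rfl).trans (by gcongr)
      _ = _ := by rw [Real.rpow_sub_one hs0.ne']; ring
  calc _ ≤ _ := add_le_add e1 e2
    _ = _ := by ring

/-- The integrated sum has weights `A_l / (n - l)`, whose denominators degenerate as `l` approaches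
`n`. Subtracting `A_n` from `A_l` yields the antitone slopes, and the part removed is exactly the
integrated Dirichlet kernel. -/
theorem abs_integral_cesaroKernel_le (h0 : 0 < α) (h1 : α < 1) {s : ℝ} (hs0 : 0 < s) (hs1 : s ≤ π)
    (n : ℕ) (hns : 1 ≤ ((n : ℝ) + 1) * s) :
    |∫ u in s..π, cesaroKernel (-α) n u|
      ≤ (8 * π + 8 / (1 - α) * (1 / (1 - α) + 2 * π)) * (((n : ℝ) + 1) * s) ^ (α - 1) := by
  have hpi := Real.pi_pos
  have h2 : 0 < 1 - α := by linarith
  have hN : (0 : ℝ) < (n : ℝ) + 1 := by positivity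
  have hA := cesaroNumber_neg_pos h1 n
  have e : ∫ u in s..π, cesaroKernel (-α) n u
      = (π - s - 2 * ∑ l ∈ Finset.range n, 1 / ((n : ℝ) - l) * Real.sin (n * s - l * s))
        - 2 * (1 / cesaroNumber (-α) n) * ∑ l ∈ Finset.range n,
          (cesaroNumber (-α) l - cesaroNumber (-α) n) / ((n : ℝ) - l) *
            Real.sin (n * s - l * s) := by
    rw [integral_cesaroKernel_eq, sub_sub (π - s), Finset.mul_sum, Finset.mul_sum, Finset.mul_sum,
      ← Finset.sum_add_distrib]
    congr 1
    refine Finset.sum_congr rfl fun l _ => ?_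
    field_simp
    ring
  rw [e, add_mul]
  refine (abs_sub _ _).trans (add_le_add ?_ ?_)
  · refine (abs_integral_dirichlet_le hs0 hs1 n).trans ?_
    rw [div_eq_mul_inv, ← Real.rpow_neg_one]
    -- `(N s)^(-1) ≤ (N s)^(α-1)` because `N s ≥ 1`.
    gcongr
    linarith
  · rw [abs_mul, abs_of_pos (by positivity)]
    calc _ ≤ 2 * (1 / (1 - α) * ((n : ℝ) + 1) ^ α) *
          (4 * (1 / (1 - α) + 2 * π) * s ^ (α - 1) / ((n : ℝ) + 1)) := by
          gcongr
          · exact inv_cesaroNumber_neg_le h0 h1 n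
          · exact abs_sum_slope_mul_sin_le h0 h1 hs0 hs1 n hns
      _ = _ := by
          rw [Real.mul_rpow hN.le hs0.le, Real.rpow_sub_one hN.ne']; ring

end Neg

end DoubleFourier

end

noncomputable section

namespace DoubleFourier

/-! ### The product kernel on a quadrant -/

/-- The size of the `(C; -α)` kernel at scale `1 / N`, and of its primitive vanishing at `π`. -/
structure IsKernelBound (α C N : ℝ) (k : ℝ → ℝ) : Prop where
  continuous : Continuous k
  abs_le : ∀ s ∈ Ioc 0 π, |k s| ≤ C * (N * (N * s) ^ (α - 1))
  abs_integral_le : ∀ s ∈ Ioc 0 π, 1 ≤ N * s → |∫ u in s..π, k u| ≤ C * (N * s) ^ (α - 1)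

theorem exists_isKernelBound {α : ℝ} (h0 : 0 < α) (h1 : α < 1) :
    ∃ C, 0 < C ∧ ∀ n : ℕ, IsKernelBound α C ((n : ℝ) + 1) (cesaroKernel (-α) n) := by
  have h2 : 0 < 1 - α := by linarith
  have hpi := Real.pi_pos
  refine ⟨max (π + 2 / (1 - α) * (1 / (1 - α) + π)) (8 * π + 8 / (1 - α) * (1 / (1 - α) + 2 * π)),
    lt_max_of_lt_left (by positivity), fun n => ⟨continuous_cesaroKernel _ _, ?_, ?_⟩⟩
  · intro s hs
    have := hs.1
    refine (abs_cesaroKernel_le h0 h1 hs.1 hs.2 n).trans ?_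
    gcongr
    exact le_max_left _ _
  · intro s hs hns
    have := hs.1
    refine (abs_integral_cesaroKernel_le h0 h1 hs.1 hs.2 n hns).trans ?_
    gcongr
    exact le_max_right _ _

/-! ### Integrals of the scaled majorants -/

section Weights

variable {α β N R : ℝ}

theorem integrableOn_mul_rpow (h0 : 0 < α) (hN : 0 < N) (c : ℝ) :
    IntegrableOn (fun s => N * (N * s) ^ (α - 1)) (Ioc 0 c) := by
  have h : IntegrableOn (fun s : ℝ => N ^ α * s ^ (α - 1)) (Ioc 0 c) := by
    rcases le_or_gt 0 c with hc | hc
    · rw [← intervalIntegrable_iff_integrableOn_Ioc_of_le hc]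
      exact (intervalIntegral.intervalIntegrable_rpow' (by linarith)).const_mul _
    · simp [Ioc_eq_empty_of_le hc.le]
  exact h.congr_fun (fun s hs => (mul_mul_rpow_sub_one hN hs.1.le).symm) measurableSet_Ioc

theorem setIntegral_mul_rpow (h0 : 0 < α) (hN : 0 < N) (hR : 0 < R) :
    ∫ s in Ioc 0 (R / N), N * (N * s) ^ (α - 1) = R ^ α / α := by
  have e : ∫ s in Ioc 0 (R / N), N * (N * s) ^ (α - 1)
      = ∫ s in Ioc 0 (R / N), N ^ α * s ^ (α - 1) :=
    setIntegral_congr_fun measurableSet_Ioc fun s hs => mul_mul_rpow_sub_one hN hs.1.le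
  rw [e, ← intervalIntegral.integral_of_le (by positivity), intervalIntegral.integral_const_mul,
    integral_rpow (Or.inl (by linarith)), sub_add_cancel, Real.zero_rpow h0.ne',
    Real.div_rpow hR.le hN.le]
  field_simp
  ring

theorem weight_eqOn_Ioc (hN : 0 < N) : EqOn
    (fun s => N * (N * s) ^ (α - 1) * (max R (N * s)) ^ (β - 1))
    (fun s => N * (N * s) ^ (α - 1) * R ^ (β - 1)) (Ioc 0 (R / N)) := by
  intro s hs
  have : N * s ≤ R := by have := (le_div_iff₀ hN).1 hs.2; linarith
  simp only [max_eq_left this]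

theorem weight_eqOn_Ioi (hN : 0 < N) (hR : 0 < R) : EqOn
    (fun s => N * (N * s) ^ (α - 1) * (max R (N * s)) ^ (β - 1))
    (fun s => N ^ (α + β - 1) * s ^ (α + β - 2)) (Ioi (R / N)) := by
  intro s hs
  have hs0 : 0 < s := lt_trans (by positivity) hs
  have : R ≤ N * s := by have := (div_lt_iff₀ hN).1 hs; linarith
  simp only [max_eq_right this]
  rw [mul_assoc, ← Real.rpow_add (by positivity), show α - 1 + (β - 1) = α + β - 2 by ring,
    Real.mul_rpow hN.le hs0.le, ← mul_assoc]
  congr 1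
  rw [show α + β - 1 = 1 + (α + β - 2) by ring, Real.rpow_add hN, Real.rpow_one]

theorem integrableOn_weight (h0 : 0 < α) (hαβ : α + β < 1) (hN : 0 < N) (hR : 0 < R) :
    IntegrableOn (fun s => N * (N * s) ^ (α - 1) * (max R (N * s)) ^ (β - 1)) (Ioi 0) := by
  rw [← Ioc_union_Ioi_eq_Ioi (show 0 ≤ R / N by positivity)]
  refine IntegrableOn.union ?_ ?_
  · exact IntegrableOn.congr_fun ((integrableOn_mul_rpow h0 hN _).mul_const _)
      (weight_eqOn_Ioc hN).symm measurableSet_Ioc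
  · exact IntegrableOn.congr_fun
      ((integrableOn_Ioi_rpow_of_lt (by linarith) (by positivity)).const_mul _)
      (weight_eqOn_Ioi hN hR).symm measurableSet_Ioi

/-- In the variable `u = N s` the integral is `R^(β-1) ∫_0^R u^(α-1) du + ∫_R^∞ u^(α+β-2) du`; the
second converges because `α + β < 1`. -/
theorem setIntegral_weight (h0 : 0 < α) (hαβ : α + β < 1) (hN : 0 < N) (hR : 0 < R) :
    ∫ s in Ioi 0, N * (N * s) ^ (α - 1) * (max R (N * s)) ^ (β - 1)
      = (1 / α + 1 / (1 - α - β)) * R ^ (α + β - 1) := by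
  have hc : 0 < R / N := by positivity
  have hi := integrableOn_weight (β := β) h0 hαβ hN hR
  rw [← Ioc_union_Ioi_eq_Ioi hc.le] at hi ⊢
  rw [setIntegral_union (Ioc_disjoint_Ioi le_rfl) measurableSet_Ioi hi.left_of_union
    hi.right_of_union, setIntegral_congr_fun measurableSet_Ioc (weight_eqOn_Ioc hN),
    setIntegral_congr_fun measurableSet_Ioi (weight_eqOn_Ioi hN hR), integral_mul_const,
    setIntegral_mul_rpow h0 hN hR, integral_const_mul, integral_Ioi_rpow_of_lt (by linarith) hc,
    show α + β - 2 + 1 = α + β - 1 by ring, Real.div_rpow hR.le hN.le]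
  have hne : N ^ (α + β - 1) ≠ 0 := (Real.rpow_pos_of_pos hN _).ne'
  have e : R ^ α / α * R ^ (β - 1) = 1 / α * R ^ (α + β - 1) := by
    rw [show α + β - 1 = α + (β - 1) by ring, Real.rpow_add hR]; ring
  have h3 : 1 - α - β ≠ 0 := by linarith
  have h4 : α + β - 1 ≠ 0 := by linarith
  rw [e, add_mul]
  congr 1
  rw [show 1 - α - β = -(α + β - 1) by ring]
  field_simp

end Weights

/-- The contribution of a region on which the integration over `t` is over `(a(s), π]` with
`M a(s) = max R (N s)`. -/
theorem abs_integral_indicator_le {α β C N M R G V : ℝ} {k l : ℝ → ℝ} {g : ℝ × ℝ → ℝ}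
    {A : Set (ℝ × ℝ)} (h0 : 0 < α) (hαβ : α + β < 1) (hC : 0 ≤ C)
    (hN : 0 < N) (hM : 0 < M) (hR : 1 ≤ R) (hk : IsKernelBound α C N k)
    (hl : IsKernelBound β C M l) (hV : 0 ≤ V)
    (hF : IntegrableOn (fun p => g p * (k p.1 * l p.2)) (Ioc 0 π ×ˢ Ioc 0 π))
    (hG : ∀ s ∈ Ioc 0 π, ∀ t ∈ Ioc 0 π, |g (s, t)| ≤ G)
    (hvar : ∀ s ∈ Ioc 0 π, eVariationOn (fun t => g (s, t)) (Icc 0 π) ≤ ENNReal.ofReal V)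
    (hAm : MeasurableSet A)
    (hA : ∀ s ∈ Ioc 0 π, (Prod.mk s ⁻¹' A ∩ Ioc 0 π : Set ℝ) =ᵐ[volume]
      Ioc (max R (N * s) / M) π) :
    |∫ p in Ioc 0 π ×ˢ Ioc 0 π, A.indicator (fun p => g p * (k p.1 * l p.2)) p|
      ≤ C ^ 2 * (G + V) * ((1 / α + 1 / (1 - α - β)) * R ^ (α + β - 1)) := by
  have hpi := Real.pi_pos
  have hG0 : 0 ≤ G := (abs_nonneg _).trans (hG π ⟨hpi, le_rfl⟩ π ⟨hpi, le_rfl⟩)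
  have hFA := hF.indicator hAm
  rw [Measure.volume_eq_prod] at hFA ⊢
  rw [setIntegral_prod _ hFA]
  have hinner : ∀ s ∈ Ioc 0 π,
      |∫ t in Ioc 0 π, A.indicator (fun p => g p * (k p.1 * l p.2)) (s, t)|
        ≤ C ^ 2 * (G + V) * (N * (N * s) ^ (α - 1) * (max R (N * s)) ^ (β - 1)) := by
    intro s hs
    set a := max R (N * s) / M with ha
    have hmax : 0 < max R (N * s) := lt_max_of_lt_left (by linarith)
    have ha0 : 0 < a := by positivity
    have e1 : ∫ t in Ioc 0 π, A.indicator (fun p => g p * (k p.1 * l p.2)) (s, t)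
        = ∫ t in Ioc a π, k s * (g (s, t) * l t) := by
      have : (fun t => A.indicator (fun p => g p * (k p.1 * l p.2)) (s, t))
          = (Prod.mk s ⁻¹' A).indicator (fun t => k s * (g (s, t) * l t)) := by
        ext t
        by_cases ht : (s, t) ∈ A
        · rw [indicator_of_mem ht, indicator_of_mem (show t ∈ Prod.mk s ⁻¹' A from ht)]
          ring
        · rw [indicator_of_notMem ht, indicator_of_notMem (show t ∉ Prod.mk s ⁻¹' A from ht)]
      rw [this, integral_indicator (measurable_prodMk_left hAm),
        Measure.restrict_restrict (measurable_prodMk_left hAm), setIntegral_congr_set (hA s hs)]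
    rw [e1, integral_const_mul, abs_mul]
    have hpos : 0 ≤ C * (max R (N * s)) ^ (β - 1) * (G + V) := by positivity
    -- Second mean value theorem in `t`: for `u ≥ a` the primitive of `l` is at most `C (M u)^(β-1)
    -- ≤ C (M a)^(β-1)`, and `M a = max R (N s)`.
    have e2 : |∫ t in Ioc a π, g (s, t) * l t| ≤ C * (max R (N * s)) ^ (β - 1) * (G + V) := by
      rcases lt_or_ge π a with h | h
      · rw [Ioc_eq_empty_of_le h.le]; simpa using hpos
      rw [← intervalIntegral.integral_of_le h]
      refine (abs_integral_mul_le_of_eVariationOn_le (φ := fun t => g (s, t)) h hl.continuous hV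
        ((eVariationOn.mono _ (Icc_subset_Icc_left ha0.le)).trans (hvar s hs))
        (B := C * (max R (N * s)) ^ (β - 1)) ?_).trans ?_
      · intro u hu
        have hu0 : 0 < u := ha0.trans_le hu.1
        have hmu : max R (N * s) ≤ M * u := by
          have := hu.1
          rw [ha, div_le_iff₀ hM] at this
          linarith
        have h1 : 1 ≤ max R (N * s) := hR.trans (le_max_left _ _)
        refine (hl.abs_integral_le u ⟨hu0, hu.2⟩ (h1.trans hmu)).trans ?_
        refine mul_le_mul_of_nonneg_left ?_ hC
        rcases le_or_gt β 1 with hb | hb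
        · exact Real.rpow_le_rpow_of_nonpos hmax hmu (by linarith)
        · linarith
      · have := hG s hs a ⟨ha0, h⟩
        gcongr
    have hs0 := hs.1
    calc _ ≤ C * (N * (N * s) ^ (α - 1)) * (C * (max R (N * s)) ^ (β - 1) * (G + V)) :=
          mul_le_mul (hk.abs_le s hs) e2 (abs_nonneg _) (by positivity)
      _ = _ := by ring
  have hw := integrableOn_weight (β := β) h0 hαβ hN (zero_lt_one.trans_le hR)
  have hsub : Ioc 0 π ⊆ Ioi (0 : ℝ) := fun s hs => hs.1
  have hfin := norm_integral_le_of_norm_le ((hw.mono_set hsub).const_mul (C ^ 2 * (G + V)))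
    ((ae_restrict_iff' measurableSet_Ioc).2 (Eventually.of_forall fun s hs =>
      (Real.norm_eq_abs _).trans_le (hinner s hs)))
  refine hfin.trans ?_
  rw [integral_const_mul, ← setIntegral_weight h0 hαβ hN (zero_lt_one.trans_le hR)]
  refine mul_le_mul_of_nonneg_left ?_ (by positivity)
  refine setIntegral_mono_set hw ?_ hsub.eventuallyLE
  refine (ae_restrict_iff' measurableSet_Ioi).2 (Eventually.of_forall fun s hs => ?_)
  have : 0 < s := hs
  have hmax : 0 < max R (N * s) := lt_max_of_lt_left (by linarith)
  simp only [Pi.zero_apply]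
  positivity

/-- The square is cut into the box `D` at scale `R`, where `g` is small and the kernels are
integrated in absolute value, and two outer regions `A` and `B`, where cancellation is used in the
variable with the larger scaled value. -/
theorem abs_integral_mul_kernels_le {α β C N M R G V η : ℝ} {k l : ℝ → ℝ} {g : ℝ × ℝ → ℝ}
    (hα : 0 < α) (hβ : 0 < β) (hαβ : α + β < 1) (hC : 0 ≤ C)
    (hR : 1 ≤ R) (hN : R ≤ N) (hM : R ≤ M) (hk : IsKernelBound α C N k)
    (hl : IsKernelBound β C M l) (hV : 0 ≤ V) (hη : 0 ≤ η)
    (hF : IntegrableOn (fun p => g p * (k p.1 * l p.2)) (Ioc 0 π ×ˢ Ioc 0 π))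
    (hG : ∀ s ∈ Ioc 0 π, ∀ t ∈ Ioc 0 π, |g (s, t)| ≤ G)
    (hvar₂ : ∀ s ∈ Ioc 0 π, eVariationOn (fun t => g (s, t)) (Icc 0 π) ≤ ENNReal.ofReal V)
    (hvar₁ : ∀ t ∈ Ioc 0 π, eVariationOn (fun s => g (s, t)) (Icc 0 π) ≤ ENNReal.ofReal V)
    (hsmall : ∀ s ∈ Ioc 0 (R / N), ∀ t ∈ Ioc 0 (R / M), |g (s, t)| ≤ η) :
    |∫ p in Ioc 0 π ×ˢ Ioc 0 π, g p * (k p.1 * l p.2)|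
      ≤ C ^ 2 * (R ^ α / α * (R ^ β / β)) * η
        + C ^ 2 * (G + V) * ((1 / α + 1 / β + 2 / (1 - α - β)) * R ^ (α + β - 1)) := by
  have hpi := Real.pi_pos
  have hR0 : 0 < R := by linarith
  have hN0 : 0 < N := by linarith
  have hM0 : 0 < M := by linarith
  set Q : Set (ℝ × ℝ) := Ioc 0 π ×ˢ Ioc 0 π with hQ
  set F : ℝ × ℝ → ℝ := fun p => g p * (k p.1 * l p.2) with hFdef
  set A : Set (ℝ × ℝ) := {p | R < M * p.2} ∩ {p | N * p.1 ≤ M * p.2} with hA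
  set B : Set (ℝ × ℝ) := {p | R < N * p.1} ∩ {p | M * p.2 < N * p.1} with hB
  set D : Set (ℝ × ℝ) := {p | N * p.1 ≤ R} ∩ {p | M * p.2 ≤ R} with hD
  have hAm : MeasurableSet A :=
    (measurableSet_lt (by fun_prop) (by fun_prop)).inter
      (measurableSet_le (by fun_prop) (by fun_prop))
  have hBm : MeasurableSet B :=
    (measurableSet_lt (by fun_prop) (by fun_prop)).inter
      (measurableSet_lt (by fun_prop) (by fun_prop))
  have hDm : MeasurableSet D :=
    (measurableSet_le (by fun_prop) (by fun_prop)).inter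
      (measurableSet_le (by fun_prop) (by fun_prop))
  have hsplit : ∀ p, F p = D.indicator F p + (A.indicator F p + B.indicator F p) := by
    intro p
    simp only [indicator, hA, hB, hD, mem_inter_iff, mem_ofPred_eq]
    split_ifs <;> first | (simp only [add_zero, zero_add]; done) | (exfalso; grind)
  have e : ∫ p in Q, F p = (∫ p in Q, D.indicator F p) +
      ((∫ p in Q, A.indicator F p) + ∫ p in Q, B.indicator F p) := by
    have h1 := hF.indicator hAm
    have h2 := hF.indicator hBm
    rw [← integral_add h1 h2, integral_congr_ae (Eventually.of_forall hsplit)]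
    exact integral_add (hF.indicator hDm) (h1.add h2)
  have bA : |∫ p in Q, A.indicator F p|
      ≤ C ^ 2 * (G + V) * ((1 / α + 1 / (1 - α - β)) * R ^ (α + β - 1)) := by
    refine abs_integral_indicator_le hα hαβ hC hN0 hM0 hR hk hl hV hF hG hvar₂ hAm ?_
    intro s hs
    rcases le_or_gt (N * s) R with h | h
    · rw [max_eq_left h]
      suffices hs : Prod.mk s ⁻¹' A ∩ Ioc 0 π = Ioc (R / M) π by
        rw [hs]; exact EventuallyEq.rfl
      ext t
      simp only [hA, mem_inter_iff, mem_preimage, mem_ofPred_eq, mem_Ioc, div_lt_iff₀ hM0]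
      constructor
      · rintro ⟨⟨h1, h2⟩, h3, h4⟩; exact ⟨by linarith, h4⟩
      · rintro ⟨h1, h2⟩
        exact ⟨⟨by linarith, by linarith⟩, by by_contra! h3; nlinarith, h2⟩
    -- Ties `N s = M t` belong to `A`, so the section is closed on the left here and agrees with the
    -- half-open interval only up to a null set.
    · rw [max_eq_right h.le]
      suffices hs : Prod.mk s ⁻¹' A ∩ Ioc 0 π = Icc (N * s / M) π by
        rw [hs]; exact Ioc_ae_eq_Icc.symm
      ext t
      simp only [hA, mem_inter_iff, mem_preimage, mem_ofPred_eq, mem_Ioc, mem_Icc, div_le_iff₀ hM0]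
      constructor
      · rintro ⟨⟨h1, h2⟩, h3, h4⟩; exact ⟨by linarith, h4⟩
      · rintro ⟨h1, h2⟩
        exact ⟨⟨by linarith, by linarith⟩, by by_contra! h3; nlinarith, h2⟩
  have bB : |∫ p in Q, B.indicator F p|
      ≤ C ^ 2 * (G + V) * ((1 / β + 1 / (1 - β - α)) * R ^ (β + α - 1)) := by
    -- Exchanging the coordinates reduces `B` to the estimate used for `A`, with `α` and `β`
    -- interchanged.
    have e1 : ∫ p in Q, B.indicator F p = ∫ p in Q,
        (Prod.swap ⁻¹' B).indicator (fun p => g p.swap * (l p.1 * k p.2)) p := by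
      rw [hQ, Measure.volume_eq_prod, ← setIntegral_prod_swap]
      refine setIntegral_congr_fun (measurableSet_Ioc.prod measurableSet_Ioc) fun p _ => ?_
      simp only [indicator, mem_preimage, hFdef, Prod.fst_swap, Prod.snd_swap]
      split_ifs <;> ring
    rw [e1]
    refine abs_integral_indicator_le (g := fun p => g p.swap) hβ (by linarith) hC hM0 hN0 hR hl hk
      hV ?_ (fun s hs t ht => hG t ht s hs) hvar₁ (measurable_swap hBm) ?_
    · have := hF
      rw [hQ, Measure.volume_eq_prod] at this
      replace this := this.swap
      rw [Measure.volume_eq_prod]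
      refine this.congr_fun (fun p _ => ?_) (measurableSet_Ioc.prod measurableSet_Ioc)
      simp only [Function.comp, hFdef, Prod.fst_swap, Prod.snd_swap]; ring
    · intro t ht
      suffices hs : Prod.mk t ⁻¹' (Prod.swap ⁻¹' B) ∩ Ioc 0 π = Ioc (max R (M * t) / N) π by
        rw [hs]; exact EventuallyEq.rfl
      ext s
      simp only [hB, mem_inter_iff, mem_preimage, mem_ofPred_eq, mem_Ioc, div_lt_iff₀ hN0,
        Prod.swap_prod_mk, max_lt_iff]
      constructor
      · rintro ⟨⟨h1, h2⟩, h3, h4⟩; exact ⟨⟨by linarith, by linarith⟩, h4⟩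
      · rintro ⟨⟨h1, h2⟩, h3⟩
        exact ⟨⟨by linarith, by linarith⟩, by by_contra! h3; nlinarith, h3⟩
  have bD : |∫ p in Q, D.indicator F p| ≤ C ^ 2 * (R ^ α / α * (R ^ β / β)) * η := by
    have hle : ∀ {L : ℝ}, R ≤ L → R / L ≤ π := fun {L} h => by
      have : R / L ≤ 1 := div_le_one_of_le₀ h (by linarith)
      linarith [Real.pi_gt_three]
    have hset : D ∩ Q = Ioc 0 (R / N) ×ˢ Ioc 0 (R / M) := by
      ext ⟨s, t⟩
      simp only [hD, hQ, mem_inter_iff, mem_ofPred_eq, mem_prod, mem_Ioc, le_div_iff₀ hN0,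
        le_div_iff₀ hM0]
      constructor
      · rintro ⟨⟨h1, h2⟩, ⟨h3, h4⟩, h5, h6⟩
        exact ⟨⟨h3, by linarith⟩, h5, by linarith⟩
      · rintro ⟨⟨h1, h2⟩, h3, h4⟩
        exact ⟨⟨by linarith, by linarith⟩, ⟨h1, ((le_div_iff₀ hN0).2 h2).trans (hle hN)⟩,
          h3, ((le_div_iff₀ hM0).2 h4).trans (hle hM)⟩
    rw [integral_indicator hDm, Measure.restrict_restrict hDm, hset, Measure.volume_eq_prod,
      ← Measure.prod_restrict]
    have hint := ((integrableOn_mul_rpow hα hN0 (R / N)).mul_prod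
      (integrableOn_mul_rpow hβ hM0 (R / M))).const_mul (C ^ 2 * η)
    have hb := norm_integral_le_of_norm_le (f := F) hint ?_
    · refine hb.trans (le_of_eq ?_)
      rw [integral_const_mul, integral_prod_mul (fun s => N * (N * s) ^ (α - 1))
        (fun t => M * (M * t) ^ (β - 1)), setIntegral_mul_rpow hα hN0 hR0,
        setIntegral_mul_rpow hβ hM0 hR0]
      ring
    · rw [Measure.prod_restrict, ae_restrict_iff' (measurableSet_Ioc.prod measurableSet_Ioc)]
      refine Eventually.of_forall ?_
      rintro ⟨s, t⟩ ⟨hs, ht⟩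
      have hs0 := hs.1
      have ht0 := ht.1
      simp only [hFdef, norm_mul, Real.norm_eq_abs]
      calc _ ≤ η * (C * (N * (N * s) ^ (α - 1)) * (C * (M * (M * t) ^ (β - 1)))) := by
            gcongr
            · exact hsmall s hs t ht
            · exact hk.abs_le s ⟨hs.1, hs.2.trans (hle hN)⟩
            · exact hl.abs_le t ⟨ht.1, ht.2.trans (hle hM)⟩
        _ = _ := by ring
  rw [e]
  refine (abs_add_le _ _).trans (add_le_add bD ((abs_add_le _ _).trans ((add_le_add bA bB).trans
    (le_of_eq ?_))))
  rw [add_comm β α, show 1 - β - α = 1 - α - β by ring]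
  ring

end DoubleFourier

end

noncomputable section

namespace DoubleFourier

/-! ### Integral representation of the Cesàro means -/

theorem sum_Icc_exp_eq (i : ℕ) (s : ℝ) :
    ∑ k ∈ Finset.Icc (-(i : ℤ)) i, Complex.exp (Complex.I * k * s)
      = ((1 + 2 * ∑ k ∈ Finset.range i, Real.cos ((k + 1 : ℕ) * s) : ℝ) : ℂ) := by
  induction i with
  | zero => simp
  | succ i ih =>
    have := Finset.sum_Icc_succ_eq_add_endpoints
      (fun k : ℤ => Complex.exp (Complex.I * k * s)) (N := i)
    push_cast at this ⊢
    rw [this, ih, Finset.sum_range_succ]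
    push_cast
    rw [Complex.cos]
    rw [show Complex.I * -((i : ℂ) + 1) * s = -((i + 1) * s) * Complex.I by ring,
      show Complex.I * ((i : ℂ) + 1) * s = ((i + 1) * s) * Complex.I by ring]
    ring

/-- Summation by parts, as `A_j^(a-1) = A_j^a - A_(j-1)^a`. -/
theorem sum_cesaroNumber_sub_one_mul (a : ℝ) (e : ℕ → ℝ) (q : ℕ) :
    ∑ j ∈ Finset.range (q + 1), cesaroNumber (a - 1) j * e j
      = cesaroNumber a q * e q + ∑ j ∈ Finset.range q, cesaroNumber a j * (e j - e (j + 1)) := by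
  induction q with
  | zero => simp [cesaroNumber_zero]
  | succ q ih =>
    rw [Finset.sum_range_succ, ih, cesaroNumber_sub_one, Finset.sum_range_succ _ q]; ring

theorem sum_cesaroNumber_mul_sum_exp (a : ℝ) (n : ℕ) (hn : cesaroNumber a n ≠ 0) (s : ℝ) :
    ∑ i ∈ Finset.range (n + 1), (1 / (cesaroNumber a n : ℂ)) * (cesaroNumber (a - 1) (n - i) : ℂ) *
      ∑ k ∈ Finset.Icc (-(i : ℤ)) i, Complex.exp (Complex.I * k * s) = (cesaroKernel a n s : ℂ) := by
  simp_rw [sum_Icc_exp_eq]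
  norm_cast
  simp_rw [mul_assoc]
  rw [← Finset.mul_sum]
  set d : ℕ → ℝ := fun i => 1 + 2 * ∑ k ∈ Finset.range i, Real.cos ((k + 1 : ℕ) * s) with hd
  have e1 : ∑ i ∈ Finset.range (n + 1), cesaroNumber (a - 1) (n - i) * d i
      = ∑ j ∈ Finset.range (n + 1), cesaroNumber (a - 1) j * d (n - j) := by
    rw [← Finset.sum_range_reflect]
    refine Finset.sum_congr rfl fun j hj => ?_
    have := Finset.mem_range.1 hj
    rw [show n + 1 - 1 - j = n - j by omega, show n - (n - j) = j by omega]
  rw [e1, sum_cesaroNumber_sub_one_mul]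
  -- Consecutive Dirichlet sums differ by a single cosine; the boundary term `A_n d(0)` provides the
  -- constant `1` of the kernel.
  have e2 : ∑ j ∈ Finset.range n, cesaroNumber a j * (d (n - j) - d (n - (j + 1)))
      = 2 * ∑ j ∈ Finset.range n, cesaroNumber a j * Real.cos (n * s - j * s) := by
    rw [Finset.mul_sum]
    refine Finset.sum_congr rfl fun j hj => ?_
    have hj' := Finset.mem_range.1 hj
    have : n - j = n - (j + 1) + 1 := by omega
    rw [this]
    simp only [hd]
    have hc : ((n - (j + 1) + 1 : ℕ) : ℝ) * s = n * s - j * s := by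
      rw [← this, Nat.cast_sub hj'.le]; ring
    rw [Finset.sum_range_succ, hc]
    ring
  rw [e2]
  simp only [hd, cesaroKernel, Nat.sub_self, Finset.range_zero, Finset.sum_empty]
  field_simp
  ring

theorem integral_mul_sum_mul_sum {ι κ : Type*} {Q : Set (ℝ × ℝ)} (hQ : IsCompact Q)
    {f : ℝ × ℝ → ℂ} (hf : IntegrableOn f Q) (s : Finset ι) (t : Finset κ) {u : ι → ℝ → ℂ}
    {v : κ → ℝ → ℂ} (hu : ∀ i ∈ s, Continuous (u i)) (hv : ∀ j ∈ t, Continuous (v j)) :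
    ∑ i ∈ s, ∑ j ∈ t, ∫ p in Q, f p * (u i p.1 * v j p.2)
      = ∫ p in Q, f p * ((∑ i ∈ s, u i p.1) * ∑ j ∈ t, v j p.2) := by
  have hi : ∀ i ∈ s, ∀ j ∈ t, IntegrableOn (fun p => f p * (u i p.1 * v j p.2)) Q := by
    intro i hi j hj
    have h1 := hu i hi
    have h2 := hv j hj
    exact hf.mul_continuousOn (by fun_prop) hQ
  simp_rw [Finset.sum_mul_sum, Finset.mul_sum]
  rw [integral_finsetSum _ fun i hi' => integrable_finsetSum _ fun j hj => hi i hi' j hj]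
  refine Finset.sum_congr rfl fun i hi' => ?_
  rw [integral_finsetSum _ fun j hj => hi i hi' j hj]

theorem isCompact_square : IsCompact (Icc 0 (2 * π) ×ˢ Icc 0 (2 * π) : Set (ℝ × ℝ)) :=
  isCompact_Icc.prod isCompact_Icc

theorem partialSum_eq_integral {f : ℝ × ℝ → ℝ} (hf : IsL1 f) (i j : ℕ) (x y : ℝ) :
    partialSum f i j (x, y) = ∫ p in Icc 0 (2 * π) ×ˢ Icc 0 (2 * π),
      (1 / (4 * (π : ℂ) ^ 2) * (f p : ℂ)) *
        ((∑ k ∈ Finset.Icc (-(i : ℤ)) i, Complex.exp (Complex.I * k * (x - p.1 : ℝ))) *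
          ∑ l ∈ Finset.Icc (-(j : ℤ)) j, Complex.exp (Complex.I * l * (y - p.2 : ℝ))) := by
  have hf' : IntegrableOn (fun p => 1 / (4 * (π : ℂ) ^ 2) * (f p : ℂ))
    (Icc 0 (2 * π) ×ˢ Icc 0 (2 * π)) := (Integrable.ofReal hf).const_mul _
  rw [← integral_mul_sum_mul_sum isCompact_square hf' _ _
    (u := fun (k : ℤ) w => Complex.exp (Complex.I * k * (x - w : ℝ)))
    (v := fun (l : ℤ) w => Complex.exp (Complex.I * l * (y - w : ℝ)))
    (fun k _ => by fun_prop) (fun l _ => by fun_prop)]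
  unfold partialSum fourierCoeff₂
  refine Finset.sum_congr rfl fun k _ => Finset.sum_congr rfl fun l _ => ?_
  rw [mul_assoc, mul_assoc, ← integral_mul_const, ← integral_const_mul]
  refine integral_congr_ae (Eventually.of_forall fun p => ?_)
  have e1 : Complex.exp (Complex.I * k * (x - p.1 : ℝ))
      = Complex.exp (Complex.I * k * x) * Complex.exp (-(Complex.I * k * (p.1 : ℂ))) := by
    rw [← Complex.exp_add]; push_cast; ring_nf
  have e2 : Complex.exp (Complex.I * l * (y - p.2 : ℝ))
      = Complex.exp (Complex.I * l * y) * Complex.exp (-(Complex.I * l * (p.2 : ℂ))) := by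
    rw [← Complex.exp_add]; push_cast; ring_nf
  simp only [e1, e2]
  ring

theorem cesaroMean_eq_integral {f : ℝ × ℝ → ℝ} (hf : IsL1 f) {a b : ℝ} {n m : ℕ}
    (hn : cesaroNumber a n ≠ 0) (hm : cesaroNumber b m ≠ 0) (x y : ℝ) :
    cesaroMean a b f n m (x, y) = ((1 / (4 * π ^ 2) * ∫ p in Icc 0 (2 * π) ×ˢ Icc 0 (2 * π),
      f p * (cesaroKernel a n (x - p.1) * cesaroKernel b m (y - p.2)) : ℝ) : ℂ) := by
  have hf' : IntegrableOn (fun p => 1 / (4 * (π : ℂ) ^ 2) * (f p : ℂ))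
    (Icc 0 (2 * π) ×ˢ Icc 0 (2 * π)) := (Integrable.ofReal hf).const_mul _
  have key := integral_mul_sum_mul_sum isCompact_square hf' (Finset.range (n + 1))
    (Finset.range (m + 1))
    (u := fun i w => (1 / (cesaroNumber a n : ℂ)) * (cesaroNumber (a - 1) (n - i) : ℂ) *
      ∑ k ∈ Finset.Icc (-(i : ℤ)) i, Complex.exp (Complex.I * k * (x - w : ℝ)))
    (v := fun j w => (1 / (cesaroNumber b m : ℂ)) * (cesaroNumber (b - 1) (m - j) : ℂ) *
      ∑ l ∈ Finset.Icc (-(j : ℤ)) j, Complex.exp (Complex.I * l * (y - w : ℝ)))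
    (fun i _ => by fun_prop) (fun j _ => by fun_prop)
  simp_rw [sum_cesaroNumber_mul_sum_exp a n hn, sum_cesaroNumber_mul_sum_exp b m hm] at key
  have e : ((1 / (4 * π ^ 2) * ∫ p in Icc 0 (2 * π) ×ˢ Icc 0 (2 * π),
      f p * (cesaroKernel a n (x - p.1) * cesaroKernel b m (y - p.2)) : ℝ) : ℂ)
      = ∫ p in Icc 0 (2 * π) ×ˢ Icc 0 (2 * π), (1 / (4 * (π : ℂ) ^ 2) * (f p : ℂ)) *
        ((cesaroKernel a n (x - p.1) : ℂ) * (cesaroKernel b m (y - p.2) : ℂ)) := by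
    rw [← integral_const_mul, ← integral_complex_ofReal]
    refine integral_congr_ae (Eventually.of_forall fun p => ?_)
    simp only
    push_cast
    ring
  rw [e, ← key]
  unfold cesaroMean
  rw [Finset.mul_sum]
  refine Finset.sum_congr rfl fun i _ => ?_
  rw [Finset.mul_sum]
  refine Finset.sum_congr rfl fun j _ => ?_
  rw [partialSum_eq_integral hf, ← integral_const_mul, ← integral_const_mul]
  refine integral_congr_ae (Eventually.of_forall fun p => ?_)
  simp only
  ring

end DoubleFourier

end

noncomputable section

namespace DoubleFourier

/-! ### Periodic functions of bounded variation -/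

section OneVariable

variable {φ : ℝ → ℝ} {V : ℝ}

theorem eVariationOn_sub_const (φ : ℝ → ℝ) (q : ℝ) (s : Set ℝ) :
    eVariationOn (fun t => φ t - q) s = eVariationOn φ s := by
  simp only [eVariationOn, edist_sub_right]

theorem eVariationOn_Icc_two_periods_le (hφ : Function.Periodic φ (2 * π)) (hV : 0 ≤ V)
    (hv : eVariationOn φ (Icc 0 (2 * π)) ≤ ENNReal.ofReal V) :
    eVariationOn φ (Icc 0 (4 * π)) ≤ ENNReal.ofReal (2 * V) := by
  have hpi := Real.pi_pos
  have h := eVariationOn.Icc_add_Icc φ (s := univ) (show 0 ≤ 2 * π by positivity)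
    (show 2 * π ≤ 4 * π by linarith) (mem_univ _)
  simp only [univ_inter] at h
  have h2 : eVariationOn φ (Icc (2 * π) (4 * π)) ≤ eVariationOn φ (Icc 0 (2 * π)) := by
    have e : eVariationOn φ (Icc (2 * π) (4 * π))
        = eVariationOn (φ ∘ fun t => t - 2 * π) (Icc (2 * π) (4 * π)) := by
      congr 1; ext t; exact (hφ.sub_eq t).symm
    rw [e]
    refine eVariationOn.comp_le_of_monotoneOn φ _ (fun a _ b _ hab => ?_) fun t ht => ?_
    · simpa using hab
    · exact ⟨by linarith [ht.1], by linarith [ht.2]⟩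
  rw [← h, two_mul V, ENNReal.ofReal_add hV hV]
  exact add_le_add hv (h2.trans hv)

/-- After reduction of `x` modulo `2π`, the half-period window lies in `[0, 4π]` but may straddle
`2π`, which accounts for the factor `2`. -/
theorem eVariationOn_add_mul_le (hφ : Function.Periodic φ (2 * π)) (hV : 0 ≤ V)
    (hv : eVariationOn φ (Icc 0 (2 * π)) ≤ ENNReal.ofReal V) {ε : ℝ} (hε : ε = 1 ∨ ε = -1)
    (x : ℝ) : eVariationOn (fun s => φ (x + ε * s)) (Icc 0 π) ≤ ENNReal.ofReal (2 * V) := by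
  have hpi := Real.pi_pos
  refine le_trans ?_ (eVariationOn_Icc_two_periods_le hφ hV hv)
  have hx := toIcoMod_mem_Ico (show 0 < 2 * π by positivity) 0 x
  have hd := toIcoMod_add_toIcoDiv_zsmul (show 0 < 2 * π by positivity) 0 x
  set x₀ := toIcoMod (show 0 < 2 * π by positivity) 0 x
  set k := toIcoDiv (show 0 < 2 * π by positivity) 0 x
  rw [zero_add] at hx
  have hxs : ∀ s, φ (x + ε * s) = φ (x₀ + ε * s) := by
    intro s
    rw [← hd, add_right_comm]
    exact hφ.zsmul k _
  rcases hε with rfl | rfl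
  · have e : (fun s => φ (x + 1 * s)) = φ ∘ fun s => x₀ + s := by
      ext s; rw [hxs]; simp
    rw [e]
    refine eVariationOn.comp_le_of_monotoneOn φ _ (fun a _ b _ hab => ?_) fun t ht => ?_
    · simpa using hab
    · exact ⟨by linarith [ht.1, hx.1], by linarith [ht.2, hx.2]⟩
  · have e : (fun s => φ (x + (-1) * s)) = φ ∘ fun s => x₀ + 2 * π - s := by
      ext s; rw [hxs, Function.comp_apply, ← hφ]; ring_nf
    rw [e]
    refine eVariationOn.comp_le_of_antitoneOn φ _ (fun a _ b _ hab => ?_) fun t ht => ?_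
    · linarith
    · exact ⟨by linarith [ht.2, hx.1], by linarith [ht.1, hx.2]⟩

theorem abs_sub_le_of_periodic (hφ : Function.Periodic φ (2 * π)) (hV : 0 ≤ V)
    (hv : eVariationOn φ (Icc 0 (2 * π)) ≤ ENNReal.ofReal V) (x y : ℝ) : |φ x - φ y| ≤ V := by
  obtain ⟨x', hx', ex⟩ := hφ.exists_mem_Ico₀ (by positivity) x
  obtain ⟨y', hy', ey⟩ := hφ.exists_mem_Ico₀ (by positivity) y
  rw [ex, ey]
  exact abs_sub_le_of_eVariationOn_le hv hV (Ico_subset_Icc_self hx') (Ico_subset_Icc_self hy')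

theorem intervalIntegrable_of_periodic (hφ : Function.Periodic φ (2 * π))
    (hv : eVariationOn φ (Icc 0 (2 * π)) ≤ ENNReal.ofReal V) (a b : ℝ) :
    IntervalIntegrable φ volume a b :=
  hφ.intervalIntegrable₀ (by positivity) (intervalIntegrable_of_eVariationOn_le (by positivity) hv)
    a b

/-- Folding the integral over a period about the point `x`. -/
theorem intervalIntegral_period_eq_fold {φ : ℝ → ℝ} (hφ : Function.Periodic φ (2 * π))
    (hi : IntervalIntegrable φ volume 0 (2 * π)) (x : ℝ) :
    ∫ u in 0..2 * π, φ u
      = (∫ s in 0..π, φ (x + 1 * s)) + ∫ s in 0..π, φ (x + (-1) * s) := by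
  have hi' := fun a b => hφ.intervalIntegrable₀ (by positivity) hi a b
  have h := hφ.intervalIntegral_add_eq 0 (x - π)
  rw [zero_add] at h
  have e1 : ∫ s in 0..π, φ (x + 1 * s) = ∫ u in x..x + π, φ u := by
    simp
  have e2 : ∫ s in 0..π, φ (x + (-1) * s) = ∫ u in x - π..x, φ u := by
    have := intervalIntegral.integral_comp_sub_left (a := 0) (b := π) φ x
    simpa [sub_eq_add_neg] using this
  rw [h, e1, e2, add_comm (∫ u in x..x + π, φ u),
    intervalIntegral.integral_add_adjacent_intervals (hi' _ _) (hi' _ _)]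
  ring_nf

end OneVariable

/-! ### Functions of bounded partial variation -/

section TwoVariables

variable {f : ℝ × ℝ → ℝ}

theorem IsBiperiodic.left (hper : IsBiperiodic f) (y : ℝ) :
    Function.Periodic (fun x => f (x, y)) (2 * π) := fun x => hper.1 x y

theorem IsBiperiodic.right (hper : IsBiperiodic f) (x : ℝ) :
    Function.Periodic (fun y => f (x, y)) (2 * π) := fun y => hper.2 x y

/-- A uniform bound for the variations of all sections, over one period. -/
structure IsPBVWith (V : ℝ) (f : ℝ × ℝ → ℝ) : Prop where
  nonneg : 0 ≤ V
  left : ∀ y, eVariationOn (fun x => f (x, y)) (Icc 0 (2 * π)) ≤ ENNReal.ofReal V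
  right : ∀ x, eVariationOn (fun y => f (x, y)) (Icc 0 (2 * π)) ≤ ENNReal.ofReal V

theorem IsPBV.exists_isPBVWith (hf : IsPBV f) (hper : IsBiperiodic f) : ∃ V, IsPBVWith V f := by
  unfold IsPBV at hf
  set S := (⨆ y ∈ Icc 0 (2 * π), eVariationOn (fun x => f (x, y)) (Icc 0 (2 * π))) +
    (⨆ x ∈ Icc 0 (2 * π), eVariationOn (fun y => f (x, y)) (Icc 0 (2 * π))) with hS
  refine ⟨S.toReal, ENNReal.toReal_nonneg, fun y => ?_, fun x => ?_⟩ <;>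
    rw [ENNReal.ofReal_toReal hf.ne]
  · have e : (fun x => f (x, y)) = fun x => f (x, toIcoMod (show 0 < 2 * π by positivity) 0 y) := by
      ext x
      conv_lhs => rw [← toIcoMod_add_toIcoDiv_zsmul (show 0 < 2 * π by positivity) 0 y]
      exact (hper.right x).zsmul _ _
    rw [e]
    refine le_trans ?_ le_self_add
    have hmem := toIcoMod_mem_Ico (show 0 < 2 * π by positivity) 0 y
    rw [zero_add] at hmem
    exact le_iSup₂ (f := fun y (_ : y ∈ Icc 0 (2 * π)) =>
      eVariationOn (fun x => f (x, y)) (Icc 0 (2 * π))) _ (Ico_subset_Icc_self hmem)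
  · have e : (fun y => f (x, y)) = fun y => f (toIcoMod (show 0 < 2 * π by positivity) 0 x, y) := by
      ext y
      conv_lhs => rw [← toIcoMod_add_toIcoDiv_zsmul (show 0 < 2 * π by positivity) 0 x]
      exact (hper.left y).zsmul _ _
    rw [e]
    refine le_trans ?_ le_add_self
    have hmem := toIcoMod_mem_Ico (show 0 < 2 * π by positivity) 0 x
    rw [zero_add] at hmem
    exact le_iSup₂ (f := fun x (_ : x ∈ Icc 0 (2 * π)) =>
      eVariationOn (fun y => f (x, y)) (Icc 0 (2 * π))) _ (Ico_subset_Icc_self hmem)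

theorem IsPBVWith.abs_sub_le {V : ℝ} (hf : IsPBVWith V f) (hper : IsBiperiodic f) (p q : ℝ × ℝ) :
    |f p - f q| ≤ 2 * V := by
  have h1 := abs_sub_le_of_periodic (hper.left p.2) hf.nonneg (hf.left p.2) p.1 q.1
  have h2 := abs_sub_le_of_periodic (hper.right q.1) hf.nonneg (hf.right q.1) p.2 q.2
  have := _root_.abs_sub_le (f p) (f (q.1, p.2)) (f q)
  simp only [Prod.mk.eta] at h1 h2
  linarith

/-- Integrability is given on one square only; countably many of its translates cover the plane. -/
theorem IsBiperiodic.aemeasurable (hper : IsBiperiodic f) (hf : IsL1 f) : AEMeasurable f := by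
  have hcov : (⋃ kl : ℤ × ℤ, (fun p : ℝ × ℝ => p - (kl.1 • (2 * π), kl.2 • (2 * π))) ⁻¹'
      (Icc 0 (2 * π) ×ˢ Icc 0 (2 * π))) = univ := by
    refine eq_univ_of_forall fun p => mem_iUnion.2 ?_
    have hpos : 0 < 2 * π := by positivity
    refine ⟨(toIcoDiv hpos 0 p.1, toIcoDiv hpos 0 p.2), ?_⟩
    have h1 := toIcoMod_mem_Ico hpos 0 p.1
    have h2 := toIcoMod_mem_Ico hpos 0 p.2
    rw [zero_add] at h1 h2
    exact ⟨Ico_subset_Icc_self h1, Ico_subset_Icc_self h2⟩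
  rw [← Measure.restrict_univ (μ := (volume : Measure (ℝ × ℝ))), ← hcov, aemeasurable_iUnion_iff]
  rintro ⟨k, l⟩
  have hmp := (measurePreserving_sub_right (volume : Measure (ℝ × ℝ))
    (k • (2 * π), l • (2 * π))).restrict_preimage
      (measurableSet_Icc.prod measurableSet_Icc : MeasurableSet (Icc 0 (2 * π) ×ˢ Icc 0 (2 * π)))
  have hfe : f = f ∘ fun p : ℝ × ℝ => p - (k • (2 * π), l • (2 * π)) := by
    ext p
    have h1 := (hper.left p.2).sub_zsmul_eq (x := p.1) k
    have h2 := (hper.right (p.1 - k • (2 * π))).sub_zsmul_eq (x := p.2) l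
    exact (h2.trans h1).symm
  rw [hfe]
  exact hf.aemeasurable.comp_quasiMeasurePreserving hmp.quasiMeasurePreserving

theorem measurePreserving_add_mul {ε : ℝ} (hε : ε = 1 ∨ ε = -1) (x : ℝ) :
    MeasurePreserving (fun s : ℝ => x + ε * s) := by
  rcases hε with rfl | rfl
  · simpa using measurePreserving_add_left (volume : Measure ℝ) x
  · simpa [sub_eq_add_neg] using Measure.measurePreserving_sub_left (volume : Measure ℝ) x

theorem integrableOn_comp_mul {V : ℝ} (hper : IsBiperiodic f) (hL1 : IsL1 f)
    (hf : IsPBVWith V f) {ε₁ ε₂ : ℝ} (h₁ : ε₁ = 1 ∨ ε₁ = -1) (h₂ : ε₂ = 1 ∨ ε₂ = -1) (x y : ℝ)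
    {h : ℝ × ℝ → ℝ} (hh : Continuous h) :
    IntegrableOn (fun p : ℝ × ℝ => f (x + ε₁ * p.1, y + ε₂ * p.2) * h p) (Ioc 0 π ×ˢ Ioc 0 π) := by
  have hmp := (measurePreserving_add_mul h₁ x).prod (measurePreserving_add_mul h₂ y)
  have hm : AEMeasurable (fun p : ℝ × ℝ => f (x + ε₁ * p.1, y + ε₂ * p.2)) volume :=
    (hper.aemeasurable hL1).comp_quasiMeasurePreserving hmp.quasiMeasurePreserving
  have hcpt : IsCompact (Icc 0 π ×ˢ Icc 0 π : Set (ℝ × ℝ)) := isCompact_Icc.prod isCompact_Icc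
  have hi : IntegrableOn (fun p : ℝ × ℝ => f (x + ε₁ * p.1, y + ε₂ * p.2))
      (Icc 0 π ×ˢ Icc 0 π) := by
    refine Measure.integrableOn_of_bounded (M := |f 0| + 2 * V) hcpt.measure_lt_top.ne
      hm.aestronglyMeasurable (Eventually.of_forall fun p => ?_)
    have h1 := hf.abs_sub_le hper (x + ε₁ * p.1, y + ε₂ * p.2) 0
    have h2 := abs_sub_abs_le_abs_sub (f (x + ε₁ * p.1, y + ε₂ * p.2)) (f 0)
    rw [Real.norm_eq_abs]
    linarith
  exact (hi.mul_continuousOn hh.continuousOn hcpt).mono_set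
    (prod_mono Ioc_subset_Icc_self Ioc_subset_Icc_self)

/-- Folding an integral over the period square about the point `(x, y)`. -/
theorem setIntegral_square_eq_fold {V : ℝ} (hper : IsBiperiodic f) (hL1 : IsL1 f)
    (hf : IsPBVWith V f) {k l : ℝ → ℝ} (hk : Continuous k) (hl : Continuous l)
    (hkp : Function.Periodic k (2 * π)) (hlp : Function.Periodic l (2 * π))
    (hke : ∀ s, k (-s) = k s) (hle : ∀ s, l (-s) = l s) (x y : ℝ) :
    ∫ p in Icc 0 (2 * π) ×ˢ Icc 0 (2 * π), f p * (k (x - p.1) * l (y - p.2))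
      = ((∫ p in Ioc 0 π ×ˢ Ioc 0 π, f (x + 1 * p.1, y + 1 * p.2) * (k p.1 * l p.2)) +
          ∫ p in Ioc 0 π ×ˢ Ioc 0 π, f (x + 1 * p.1, y + -1 * p.2) * (k p.1 * l p.2)) +
        ((∫ p in Ioc 0 π ×ˢ Ioc 0 π, f (x + -1 * p.1, y + 1 * p.2) * (k p.1 * l p.2)) +
          ∫ p in Ioc 0 π ×ˢ Ioc 0 π, f (x + -1 * p.1, y + -1 * p.2) * (k p.1 * l p.2)) := by
  have hpi := Real.pi_pos
  set H : ℝ × ℝ → ℝ := fun p => f p * (k (x - p.1) * l (y - p.2)) with hH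
  have hHi : IntegrableOn H (Icc 0 (2 * π) ×ˢ Icc 0 (2 * π)) :=
    IntegrableOn.mul_continuousOn hL1 (by fun_prop) isCompact_square
  have hHi' : Integrable H ((volume.restrict (Icc 0 (2 * π))).prod
      (volume.restrict (Icc 0 (2 * π)))) := by
    rw [Measure.prod_restrict]; exact hHi
  set Φ : ℝ → ℝ := fun u => ∫ v in 0..2 * π, H (u, v) with hΦ
  have hHv : ∀ u, Function.Periodic (fun v => H (u, v)) (2 * π) := by
    intro u v
    simp only [hH, hper.2 u v]
    rw [← sub_sub, hlp.sub_eq]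
  -- Bounded variation gives integrability of every section, not merely of almost every one, so the
  -- inner integral can be folded for each `u`.
  have hHvi : ∀ u, IntervalIntegrable (fun v => H (u, v)) volume 0 (2 * π) := fun u =>
    (intervalIntegrable_of_periodic (hper.right u) (hf.right u) _ _).mul_continuousOn
      (by fun_prop)
  have hΦp : Function.Periodic Φ (2 * π) := by
    intro u
    simp only [hΦ, hH, hper.1 u]
    refine intervalIntegral.integral_congr fun v _ => ?_
    rw [← sub_sub, hkp.sub_eq]
  have hΦe : ∀ u, Φ u = ∫ v in Icc 0 (2 * π), H (u, v) := fun u => by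
    simp only [hΦ]
    rw [intervalIntegral.integral_of_le (by positivity), integral_Icc_eq_integral_Ioc]
  have hΦi : IntervalIntegrable Φ volume 0 (2 * π) := by
    rw [intervalIntegrable_iff_integrableOn_Icc_of_le (by positivity)]
    refine Integrable.congr hHi'.integral_prod_left (Eventually.of_forall fun u => (hΦe u).symm)
  have e0 : ∫ p in Icc 0 (2 * π) ×ˢ Icc 0 (2 * π), H p = ∫ u in 0..2 * π, Φ u := by
    rw [Measure.volume_eq_prod, setIntegral_prod _ (by rw [← Measure.volume_eq_prod]; exact hHi),
      intervalIntegral.integral_of_le (by positivity), ← integral_Icc_eq_integral_Ioc]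
    exact integral_congr_ae (Eventually.of_forall fun u => (hΦe u).symm)
  have hfold : ∀ ε : ℝ, (ε = 1 ∨ ε = -1) → ∫ s in 0..π, Φ (x + ε * s)
      = (∫ p in Ioc 0 π ×ˢ Ioc 0 π, f (x + ε * p.1, y + 1 * p.2) * (k p.1 * l p.2)) +
          ∫ p in Ioc 0 π ×ˢ Ioc 0 π, f (x + ε * p.1, y + -1 * p.2) * (k p.1 * l p.2) := by
    intro ε hε
    have hi1 := integrableOn_comp_mul hper hL1 hf hε (Or.inl rfl : (1 : ℝ) = 1 ∨ _) x y
      (h := fun p => k p.1 * l p.2) (by fun_prop)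
    have hi2 := integrableOn_comp_mul hper hL1 hf hε (Or.inr rfl : (-1 : ℝ) = 1 ∨ _) x y
      (h := fun p => k p.1 * l p.2) (by fun_prop)
    have hkε : ∀ s, k (x - (x + ε * s)) = k s := by
      intro s
      rcases hε with rfl | rfl
      · rw [← hke s]; ring_nf
      · ring_nf
    have hsum : ∀ s, Φ (x + ε * s)
        = (∫ t in Ioc 0 π, f (x + ε * s, y + 1 * t) * (k s * l t))
          + ∫ t in Ioc 0 π, f (x + ε * s, y + -1 * t) * (k s * l t) := by
      intro s
      simp only [hΦ]
      rw [intervalIntegral_period_eq_fold (hHv _) (hHvi _) y,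
        intervalIntegral.integral_of_le hpi.le, intervalIntegral.integral_of_le hpi.le]
      congr 1 <;> refine integral_congr_ae (Eventually.of_forall fun t => ?_)
      · simp only [hH, hkε]
        rw [← hle t]; ring_nf
      · simp only [hH, hkε]
        ring_nf
    rw [Measure.volume_eq_prod] at hi1 hi2 ⊢
    rw [setIntegral_prod _ hi1, setIntegral_prod _ hi2, intervalIntegral.integral_of_le hpi.le]
    rw [IntegrableOn, ← Measure.prod_restrict] at hi1 hi2
    rw [← integral_add hi1.integral_prod_left hi2.integral_prod_left]
    exact integral_congr_ae (Eventually.of_forall hsum)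
  rw [e0, intervalIntegral_period_eq_fold hΦp hΦi x, hfold 1 (Or.inl rfl), hfold (-1) (Or.inr rfl)]

end TwoVariables

end DoubleFourier

end

noncomputable section

namespace DoubleFourier

/-! ### Convergence of the Cesàro means -/

theorem IsKernelBound.mono {α C C' N : ℝ} {k : ℝ → ℝ} (h : IsKernelBound α C N k) (hC : C ≤ C')
    (hN : 0 < N) : IsKernelBound α C' N k := by
  refine ⟨h.continuous, fun s hs => (h.abs_le s hs).trans ?_,
    fun s hs h1 => (h.abs_integral_le s hs h1).trans ?_⟩ <;>
  · have := hs.1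
    gcongr

theorem exists_isKernelBound_pair {α β : ℝ} (hα : α ∈ Ioo (0 : ℝ) 1) (hβ : β ∈ Ioo (0 : ℝ) 1) :
    ∃ C, 0 < C ∧ (∀ n : ℕ, IsKernelBound α C ((n : ℝ) + 1) (cesaroKernel (-α) n)) ∧
      ∀ n : ℕ, IsKernelBound β C ((n : ℝ) + 1) (cesaroKernel (-β) n) := by
  obtain ⟨C₁, h₁, hk₁⟩ := exists_isKernelBound hα.1 hα.2
  obtain ⟨C₂, h₂, hk₂⟩ := exists_isKernelBound hβ.1 hβ.2
  exact ⟨max C₁ C₂, lt_max_of_lt_left h₁,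
    fun n => (hk₁ n).mono (le_max_left _ _) (by positivity),
    fun n => (hk₂ n).mono (le_max_right _ _) (by positivity)⟩

theorem setIntegral_mul_kernels (a b : ℝ) (n m : ℕ) (q : ℝ) :
    ∫ p in Ioc 0 π ×ˢ Ioc 0 π, q * (cesaroKernel a n p.1 * cesaroKernel b m p.2) = π ^ 2 * q := by
  rw [integral_const_mul, Measure.volume_eq_prod, setIntegral_prod_mul (cesaroKernel a n)
      (cesaroKernel b m), ← intervalIntegral.integral_of_le Real.pi_pos.le,
    ← intervalIntegral.integral_of_le Real.pi_pos.le, integral_cesaroKernel_zero_pi,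
    integral_cesaroKernel_zero_pi]
  ring

/-- One quadrant of the folded integral, centred at the quadrant limit `q`. -/
theorem abs_quadrant_integral_sub_le {α β C V R η : ℝ} {f : ℝ × ℝ → ℝ} (hα : 0 < α) (hβ : 0 < β)
    (hαβ : α + β < 1) (hC : 0 ≤ C) (hper : IsBiperiodic f) (hL1 : IsL1 f) (hf : IsPBVWith V f)
    {n m : ℕ} (hk : IsKernelBound α C ((n : ℝ) + 1) (cesaroKernel (-α) n))
    (hl : IsKernelBound β C ((m : ℝ) + 1) (cesaroKernel (-β) m))
    (hR : 1 ≤ R) (hn : R ≤ n + 1) (hm : R ≤ m + 1) (hη : 0 ≤ η) (hη1 : η ≤ 1)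
    {ε₁ ε₂ : ℝ} (h₁ : ε₁ = 1 ∨ ε₁ = -1) (h₂ : ε₂ = 1 ∨ ε₂ = -1) (x y q : ℝ)
    (hsmall : ∀ s ∈ Ioc 0 (R / ((n : ℝ) + 1)), ∀ t ∈ Ioc 0 (R / ((m : ℝ) + 1)),
      |f (x + ε₁ * s, y + ε₂ * t) - q| ≤ η) :
    |(∫ p in Ioc 0 π ×ˢ Ioc 0 π, f (x + ε₁ * p.1, y + ε₂ * p.2) *
        (cesaroKernel (-α) n p.1 * cesaroKernel (-β) m p.2)) - π ^ 2 * q|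
      ≤ C ^ 2 * (R ^ α / α * (R ^ β / β)) * η
        + C ^ 2 * (1 + 4 * V) * ((1 / α + 1 / β + 2 / (1 - α - β)) * R ^ (α + β - 1)) := by
  have hk' := hk.continuous
  have hl' := hl.continuous
  have hi := integrableOn_comp_mul hper hL1 hf h₁ h₂ x y
    (h := fun p => cesaroKernel (-α) n p.1 * cesaroKernel (-β) m p.2) (by fun_prop)
  have hq : IntegrableOn (fun p : ℝ × ℝ => q * (cesaroKernel (-α) n p.1 * cesaroKernel (-β) m p.2))
      (Ioc 0 π ×ˢ Ioc 0 π) := by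
    refine IntegrableOn.mono_set (t := Icc 0 π ×ˢ Icc 0 π) ?_
      (prod_mono Ioc_subset_Icc_self Ioc_subset_Icc_self)
    exact ContinuousOn.integrableOn_compact (isCompact_Icc.prod isCompact_Icc) (by fun_prop)
  rw [← setIntegral_mul_kernels (-α) (-β) n m q, ← integral_sub hi hq]
  have hN : (0 : ℝ) < (n : ℝ) + 1 := by positivity
  have hM : (0 : ℝ) < (m : ℝ) + 1 := by positivity
  have hR0 : 0 < R := by linarith
  -- The variation doubles on a half-period window. The sup bound compares any value of `f` with one
  -- at the corner of the small box, which lies within `η ≤ 1` of `q`; together `G + V` becomes `1 +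
  -- 4 V`.
  have key := abs_integral_mul_kernels_le (G := 2 * V + 1) (V := 2 * V)
    (g := fun p => f (x + ε₁ * p.1, y + ε₂ * p.2) - q) hα hβ hαβ hC hR hn hm hk hl
    (by linarith [hf.nonneg]) hη ?_ ?_ ?_ ?_ hsmall
  · simp_rw [← sub_mul]
    refine key.trans (le_of_eq ?_)
    ring
  · simp_rw [sub_mul]
    exact hi.sub hq
  · intro s _ t _
    have h1 := hf.abs_sub_le hper (x + ε₁ * s, y + ε₂ * t)
      (x + ε₁ * (R / ((n : ℝ) + 1)), y + ε₂ * (R / ((m : ℝ) + 1)))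
    have h2 := hsmall _ (right_mem_Ioc.2 (div_pos hR0 hN)) _ (right_mem_Ioc.2 (div_pos hR0 hM))
    have h3 := abs_sub_le (f (x + ε₁ * s, y + ε₂ * t))
      (f (x + ε₁ * (R / ((n : ℝ) + 1)), y + ε₂ * (R / ((m : ℝ) + 1)))) q
    simp only
    linarith
  · intro s _
    simp only
    rw [eVariationOn_sub_const]
    exact eVariationOn_add_mul_le (hper.right (x + ε₁ * s)) hf.nonneg (hf.right _) h₂ y
  · intro t _
    simp only
    rw [eVariationOn_sub_const]
    exact eVariationOn_add_mul_le (hper.left (y + ε₂ * t)) hf.nonneg (hf.left _) h₁ x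

/-- A bound for the Cesàro means, uniform in the point, in terms of the oscillation
of the function on small open quadrants. -/
theorem exists_norm_cesaroMean_sub_le {α β : ℝ} (hα : α ∈ Ioo (0 : ℝ) 1) (hβ : β ∈ Ioo (0 : ℝ) 1)
    (hαβ : α + β < 1) {f : ℝ × ℝ → ℝ} (hper : IsBiperiodic f) (hL1 : IsL1 f) (hf : IsPBV f)
    {e : ℝ} (he : 0 < e) :
    ∃ η > 0, ∀ δ > 0, ∃ N : ℕ, ∀ n ≥ N, ∀ m ≥ N, ∀ x y q₁ q₂ q₃ q₄ : ℝ,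
      (∀ s ∈ Ioo 0 δ, ∀ t ∈ Ioo 0 δ, |f (x + 1 * s, y + 1 * t) - q₁| ≤ η) →
      (∀ s ∈ Ioo 0 δ, ∀ t ∈ Ioo 0 δ, |f (x + 1 * s, y + -1 * t) - q₂| ≤ η) →
      (∀ s ∈ Ioo 0 δ, ∀ t ∈ Ioo 0 δ, |f (x + -1 * s, y + 1 * t) - q₃| ≤ η) →
      (∀ s ∈ Ioo 0 δ, ∀ t ∈ Ioo 0 δ, |f (x + -1 * s, y + -1 * t) - q₄| ≤ η) →
      ‖cesaroMean (-α) (-β) f n m (x, y) - (((1 / 4) * (q₁ + q₂ + q₃ + q₄) : ℝ) : ℂ)‖ ≤ e := by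
  obtain ⟨V, hV⟩ := hf.exists_isPBVWith hper
  obtain ⟨C, hC, hk, hl⟩ := exists_isKernelBound_pair hα hβ
  set c := C ^ 2 * (1 + 4 * V) * (1 / α + 1 / β + 2 / (1 - α - β)) with hc
  -- `R` is fixed first, to make the outer regions contribute at most `e / 2`.
  obtain ⟨R, hR1, hR⟩ : ∃ R : ℝ, 1 ≤ R ∧ c * R ^ (α + β - 1) ≤ e / 2 := by
    have h := (tendsto_rpow_neg_atTop (show 0 < 1 - α - β by linarith)).const_mul c
    rw [mul_zero] at h
    obtain ⟨R, h1, h2⟩ := ((eventually_ge_atTop (1 : ℝ)).and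
      (h.eventually_le_const (half_pos he))).exists
    exact ⟨R, h1, by rwa [show α + β - 1 = -(1 - α - β) by ring]⟩
  have hR0 : 0 < R := by linarith
  have hα0 := hα.1
  have hβ0 := hβ.1
  set d := C ^ 2 * (R ^ α / α * (R ^ β / β)) with hd
  have hd0 : 0 < d := by positivity
  -- The tolerance depends on `e` through `R`, but on neither `δ` nor the point. Afterwards `N` need
  -- only ensure that the box of sides `R / (n + 1)`, `R / (m + 1)` fits inside `δ`.
  refine ⟨min 1 (e / (2 * d)), by positivity, fun δ hδ => ?_⟩
  set η := min 1 (e / (2 * d)) with hη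
  have hη0 : 0 < η := by positivity
  have hdη : d * η ≤ e / 2 := by
    calc d * η ≤ d * (e / (2 * d)) := by gcongr; exact min_le_right _ _
      _ = e / 2 := by field_simp
  obtain ⟨N, hN⟩ := exists_nat_gt (max R (R / δ))
  refine ⟨N, fun n hn m hm x y q₁ q₂ q₃ q₄ H₁ H₂ H₃ H₄ => ?_⟩
  have hbig : ∀ j : ℕ, N ≤ j → R ≤ (j : ℝ) + 1 ∧ R / ((j : ℝ) + 1) < δ := by
    intro j hj
    have hj' : (N : ℝ) ≤ j := by exact_mod_cast hj
    have h1 := (le_max_left R (R / δ)).trans_lt hN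
    have h2 := (le_max_right R (R / δ)).trans_lt hN
    refine ⟨by linarith, ?_⟩
    rw [div_lt_iff₀ (by positivity)]
    rw [div_lt_iff₀ hδ] at h2
    nlinarith
  have quad : ∀ {ε₁ ε₂ : ℝ}, (ε₁ = 1 ∨ ε₁ = -1) → (ε₂ = 1 ∨ ε₂ = -1) → ∀ q : ℝ,
      (∀ s ∈ Ioo 0 δ, ∀ t ∈ Ioo 0 δ, |f (x + ε₁ * s, y + ε₂ * t) - q| ≤ η) →
      |(∫ p in Ioc 0 π ×ˢ Ioc 0 π, f (x + ε₁ * p.1, y + ε₂ * p.2) *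
        (cesaroKernel (-α) n p.1 * cesaroKernel (-β) m p.2)) - π ^ 2 * q| ≤ e := by
    intro ε₁ ε₂ h₁ h₂ q hq
    refine (abs_quadrant_integral_sub_le hα.1 hβ.1 hαβ hC.le hper hL1 hV (hk n) (hl m) hR1
      (hbig n hn).1 (hbig m hm).1 hη0.le (min_le_left _ _) h₁ h₂ x y q fun s hs t ht =>
        hq s ⟨hs.1, hs.2.trans_lt (hbig n hn).2⟩ t ⟨ht.1, ht.2.trans_lt (hbig m hm).2⟩).trans ?_
    rw [← hd, ← mul_assoc, ← hc]
    linarith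
  have b₁ := quad (Or.inl rfl) (Or.inl rfl) q₁ H₁
  have b₂ := quad (Or.inl rfl) (Or.inr rfl) q₂ H₂
  have b₃ := quad (Or.inr rfl) (Or.inl rfl) q₃ H₃
  have b₄ := quad (Or.inr rfl) (Or.inr rfl) q₄ H₄
  rw [cesaroMean_eq_integral hL1 (cesaroNumber_neg_pos hα.2 n).ne'
      (cesaroNumber_neg_pos hβ.2 m).ne', setIntegral_square_eq_fold hper hL1 hV
      (continuous_cesaroKernel _ _) (continuous_cesaroKernel _ _) (cesaroKernel_periodic _ _)
      (cesaroKernel_periodic _ _) (cesaroKernel_neg _ _) (cesaroKernel_neg _ _),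
    ← Complex.ofReal_sub, Complex.norm_real, Real.norm_eq_abs]
  set J₁ := ∫ p in Ioc 0 π ×ˢ Ioc 0 π, f (x + 1 * p.1, y + 1 * p.2) *
    (cesaroKernel (-α) n p.1 * cesaroKernel (-β) m p.2)
  set J₂ := ∫ p in Ioc 0 π ×ˢ Ioc 0 π, f (x + 1 * p.1, y + -1 * p.2) *
    (cesaroKernel (-α) n p.1 * cesaroKernel (-β) m p.2)
  set J₃ := ∫ p in Ioc 0 π ×ˢ Ioc 0 π, f (x + -1 * p.1, y + 1 * p.2) *
    (cesaroKernel (-α) n p.1 * cesaroKernel (-β) m p.2)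
  set J₄ := ∫ p in Ioc 0 π ×ˢ Ioc 0 π, f (x + -1 * p.1, y + -1 * p.2) *
    (cesaroKernel (-α) n p.1 * cesaroKernel (-β) m p.2)
  have hpi : 1 ≤ π ^ 2 := by nlinarith [Real.pi_gt_three]
  have e1 : 1 / (4 * π ^ 2) * (J₁ + J₂ + (J₃ + J₄)) - 1 / 4 * (q₁ + q₂ + q₃ + q₄)
      = 1 / (4 * π ^ 2) * ((J₁ - π ^ 2 * q₁) + (J₂ - π ^ 2 * q₂) + ((J₃ - π ^ 2 * q₃)
        + (J₄ - π ^ 2 * q₄))) := by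
    field_simp
    ring
  rw [e1, abs_mul, abs_of_pos (by positivity), div_mul_eq_mul_div, one_mul,
    div_le_iff₀ (by positivity)]
  calc _ ≤ (e + e) + (e + e) :=
        (abs_add_le _ _).trans (add_le_add ((abs_add_le _ _).trans (add_le_add b₁ b₂))
          ((abs_add_le _ _).trans (add_le_add b₃ b₄)))
    _ ≤ e * (4 * π ^ 2) := by nlinarith

/-! ### From oscillation on small quadrants to pointwise and uniform limits -/

theorem tendsto_add_mul_nhdsGT_zero (x : ℝ) :
    Tendsto (fun s : ℝ => x + 1 * s) (𝓝[>] 0) (𝓝[>] x) ∧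
      Tendsto (fun s : ℝ => x + -1 * s) (𝓝[>] 0) (𝓝[<] x) := by
  have hc : ∀ ε : ℝ, Tendsto (fun s : ℝ => x + ε * s) (𝓝[>] 0) (𝓝 x) := by
    intro ε
    have h : ContinuousAt (fun s : ℝ => x + ε * s) 0 := by fun_prop
    have h' := h.tendsto
    rw [mul_zero, add_zero] at h'
    exact h'.mono_left nhdsWithin_le_nhds
  refine ⟨tendsto_nhdsWithin_iff.2 ⟨hc 1, ?_⟩, tendsto_nhdsWithin_iff.2 ⟨hc (-1), ?_⟩⟩ <;>
  · filter_upwards [self_mem_nhdsWithin] with s (hs : 0 < s)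
    simp [hs]

theorem exists_quadrant_le_of_tendsto {f : ℝ × ℝ → ℝ} {ε₁ ε₂ x y q η : ℝ} {l₁ l₂ : Filter ℝ}
    (h : Tendsto f (l₁ ×ˢ l₂) (𝓝 q)) (h₁ : Tendsto (fun s : ℝ => x + ε₁ * s) (𝓝[>] 0) l₁)
    (h₂ : Tendsto (fun s : ℝ => y + ε₂ * s) (𝓝[>] 0) l₂) (hη : 0 < η) :
    ∃ δ > 0, ∀ s ∈ Ioo 0 δ, ∀ t ∈ Ioo 0 δ, |f (x + ε₁ * s, y + ε₂ * t) - q| ≤ η := by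
  have h3 := (h.comp (h₁.prodMap h₂)).eventually (Metric.ball_mem_nhds q hη)
  obtain ⟨p₁, hp₁, p₂, hp₂, hp⟩ := eventually_prod_iff.1 h3
  obtain ⟨δ₁, hδ₁, H₁⟩ := mem_nhdsGT_iff_exists_Ioo_subset.1 hp₁
  obtain ⟨δ₂, hδ₂, H₂⟩ := mem_nhdsGT_iff_exists_Ioo_subset.1 hp₂
  refine ⟨min δ₁ δ₂, lt_min hδ₁ hδ₂, fun s hs t ht => ?_⟩
  have := hp (H₁ ⟨hs.1, hs.2.trans_le (min_le_left _ _)⟩)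
    (H₂ ⟨ht.1, ht.2.trans_le (min_le_right _ _)⟩)
  exact (le_of_lt (by simpa [Real.dist_eq] using this))

theorem cesaroSummableAt_of_hasQuadrantLimits {α β : ℝ} (hα : α ∈ Ioo (0 : ℝ) 1)
    (hβ : β ∈ Ioo (0 : ℝ) 1) (hαβ : α + β < 1) {f : ℝ × ℝ → ℝ} (hper : IsBiperiodic f)
    (hL1 : IsL1 f) (hf : IsPBV f) {x y q₁ q₂ q₃ q₄ : ℝ} (h : HasQuadrantLimits f x y q₁ q₂ q₃ q₄) :
    CesaroSummableAt (-α) (-β) f (x, y) ((1 / 4) * (q₁ + q₂ + q₃ + q₄)) := by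
  obtain ⟨h₁, h₂, h₃, h₄⟩ := h
  refine Metric.tendsto_nhds.2 fun e he => ?_
  obtain ⟨η, hη, H⟩ := exists_norm_cesaroMean_sub_le hα hβ hαβ hper hL1 hf (half_pos he)
  obtain ⟨xp, xm⟩ := tendsto_add_mul_nhdsGT_zero x
  obtain ⟨yp, ym⟩ := tendsto_add_mul_nhdsGT_zero y
  obtain ⟨δ₁, hδ₁, H₁⟩ := exists_quadrant_le_of_tendsto h₁ xp yp hη
  obtain ⟨δ₂, hδ₂, H₂⟩ := exists_quadrant_le_of_tendsto h₂ xp ym hη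
  obtain ⟨δ₃, hδ₃, H₃⟩ := exists_quadrant_le_of_tendsto h₃ xm yp hη
  obtain ⟨δ₄, hδ₄, H₄⟩ := exists_quadrant_le_of_tendsto h₄ xm ym hη
  set δ := min (min δ₁ δ₂) (min δ₃ δ₄)
  have hδ : 0 < δ := lt_min (lt_min hδ₁ hδ₂) (lt_min hδ₃ hδ₄)
  have s₁ : Ioo 0 δ ⊆ Ioo 0 δ₁ :=
    Ioo_subset_Ioo_right ((min_le_left _ _).trans (min_le_left _ _))
  have s₂ : Ioo 0 δ ⊆ Ioo 0 δ₂ :=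
    Ioo_subset_Ioo_right ((min_le_left _ _).trans (min_le_right _ _))
  have s₃ : Ioo 0 δ ⊆ Ioo 0 δ₃ :=
    Ioo_subset_Ioo_right ((min_le_right _ _).trans (min_le_left _ _))
  have s₄ : Ioo 0 δ ⊆ Ioo 0 δ₄ :=
    Ioo_subset_Ioo_right ((min_le_right _ _).trans (min_le_right _ _))
  obtain ⟨N, hN⟩ := H δ hδ
  filter_upwards [(eventually_ge_atTop N).prod_mk (eventually_ge_atTop N)] with nm hnm
  rw [dist_eq_norm]
  refine (hN nm.1 hnm.1 nm.2 hnm.2 x y q₁ q₂ q₃ q₄ (fun s hs t ht => H₁ s (s₁ hs) t (s₁ ht))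
    (fun s hs t ht => H₂ s (s₂ hs) t (s₂ ht)) (fun s hs t ht => H₃ s (s₃ hs) t (s₃ ht))
    (fun s hs t ht => H₄ s (s₄ hs) t (s₄ ht))).trans_lt (half_lt_self he)

theorem cesaroSummableUniformlyOn_of_continuousAt {α β : ℝ} (hα : α ∈ Ioo (0 : ℝ) 1)
    (hβ : β ∈ Ioo (0 : ℝ) 1) (hαβ : α + β < 1) {f : ℝ × ℝ → ℝ} (hper : IsBiperiodic f)
    (hL1 : IsL1 f) (hf : IsPBV f) {K : Set (ℝ × ℝ)} (hK : IsCompact K)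
    (hc : ∀ p ∈ K, ContinuousAt f p) : CesaroSummableUniformlyOn (-α) (-β) f K := by
  refine Metric.tendstoUniformlyOn_iff.2 fun e he => ?_
  obtain ⟨η, hη, H⟩ := exists_norm_cesaroMean_sub_le hα hβ hαβ hper hL1 hf (half_pos he)
  -- Compactness gives one `δ` for all base points of `K`, while the nearby second point may lie
  -- outside `K`, as the quadrants require.
  obtain ⟨δ, hδ, hδ'⟩ := Metric.mem_uniformity_dist.1
    (hK.uniformContinuousAt_of_continuousAt f hc (Metric.dist_mem_uniformity hη))
  obtain ⟨N, hN⟩ := H δ hδ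
  filter_upwards [(eventually_ge_atTop N).prod_mk (eventually_ge_atTop N)] with nm hnm
  rintro ⟨x, y⟩ hp
  have hq : ∀ {ε₁ ε₂ : ℝ}, |ε₁| = 1 → |ε₂| = 1 → ∀ s ∈ Ioo 0 δ, ∀ t ∈ Ioo 0 δ,
      |f (x + ε₁ * s, y + ε₂ * t) - f (x, y)| ≤ η := by
    intro ε₁ ε₂ h₁ h₂ s hs t ht
    have hd : dist (x, y) (x + ε₁ * s, y + ε₂ * t) < δ := by
      rw [Prod.dist_eq, max_lt_iff]
      simp only [dist_self_add_right, norm_mul, Real.norm_eq_abs, h₁, h₂, abs_of_pos hs.1,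
        abs_of_pos ht.1, one_mul]
      exact ⟨hs.2, ht.2⟩
    have := hδ' hd hp
    simp only [mem_ofPred_eq] at this
    rw [dist_comm, Real.dist_eq] at this
    exact this.le
  have h1 : |(1 : ℝ)| = 1 := abs_one
  have h2 : |(-1 : ℝ)| = 1 := by simp
  have := hN nm.1 hnm.1 nm.2 hnm.2 x y _ _ _ _ (hq h1 h1) (hq h1 h2) (hq h2 h1) (hq h2 h2)
  rw [show (1 / 4 : ℝ) * (f (x, y) + f (x, y) + f (x, y) + f (x, y)) = f (x, y) by ring] at this
  rw [dist_comm, dist_eq_norm]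
  exact this.trans_lt (half_lt_self he)

end DoubleFourier

end

theorem corollary2 (α β : ℝ) (hα : α ∈ Ioo (0 : ℝ) 1) (hβ : β ∈ Ioo (0 : ℝ) 1)
    (hαβ : α + β < 1) (f : ℝ × ℝ → ℝ) (hper : DoubleFourier.IsBiperiodic f)
    (hL1 : DoubleFourier.IsL1 f) (hf : DoubleFourier.IsPBV f) :
    (∀ x y q₁ q₂ q₃ q₄ : ℝ, DoubleFourier.HasQuadrantLimits f x y q₁ q₂ q₃ q₄ →
      DoubleFourier.CesaroSummableAt (-α) (-β) f (x, y) ((1 / 4) * (q₁ + q₂ + q₃ + q₄))) ∧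
    (∀ K : Set (ℝ × ℝ), IsCompact K → (∀ p ∈ K, ContinuousAt f p) →
      DoubleFourier.CesaroSummableUniformlyOn (-α) (-β) f K) :=
  ⟨fun _ _ _ _ _ _ h =>
      DoubleFourier.cesaroSummableAt_of_hasQuadrantLimits hα hβ hαβ hper hL1 hf h,
    fun _ hK hc =>
      DoubleFourier.cesaroSummableUniformlyOn_of_continuousAt hα hβ hαβ hper hL1 hf hK hc⟩
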